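/- Let $\mathbb{K}$ be a field of characteristic different from $2$, and let $\mathcal{E}$ be an $n$-dimensional evolution algebra over $\mathbb{K}$, i.e. a (not necessarily associative) algebra which has a natural basis: a basis $\{e_1,\dots,e_n\}$ with $e_ie_j=0$ for $i\neq j$. Its structure matrix $(a_{ik})$ is given by $e_i^2=\sum_k a_{ik}e_k$. Put $\mathcal{E}^{(1)}=\mathcal{E}$ and $\mathcal{E}^{(k+1)}=\mathcal{E}^{(k)}\mathcal{E}^{(k)}$ (linear span of products); these are the terms of the derived series. Suppose that $\mathcal{E}$ is solvable with maximum index of solvability, i.e. the least $m\ge 1$ with $\mathcal{E}^{(m)}=0$ exists and equals $n+1$. The algebra $\mathcal{E}$ is called modular if its lattice of subalgebras is modular: $\langle U,V\cap W\rangle=\langle U,V\rangle\cap W$ for all subalgebras $U,V,W$ with $U\subseteq W$, where $\langle\,\cdot\,\rangle$ denotes the generated subalgebra. A basic ideal relative to a natural basis is an ideal spanned by a (possibly empty) subset of that basis. A natural basis $\{e_1,\dots,e_n\}$ is said to be in block form if its structure matrix has rank $n-1$ and is block lower triangular, each diagonal block being the $1\times 1$ block $0$ or the $2\times 2$ block $\begin{pmatrix}1&1\\-1&-1\end{pmatrix}$.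 (For $n=0$ the rank condition is void.) For such a basis let $\Lambda$ be the set of pairs $(i,i+1)$ with $\begin{pmatrix}a_{ii}&a_{i(i+1)}\\a_{(i+1)i}&a_{(i+1)(i+1)}\end{pmatrix}=\begin{pmatrix}1&1\\-1&-1\end{pmatrix}$, let $\pi_{i(i+1)}$ be the linear projection of $\mathcal{E}$ onto $\mathrm{span}\{e_i,e_{i+1}\}$ along the other basis vectors, and consider the condition $(\ast)$ there is no subalgebra of the form $U=K+\mathrm{span}\{e_i-e_{i+1},\,e_j+\varepsilon e_{j+1}\}$ with $\varepsilon\in\{1,-1\}$, $i<j$, $(i,i+1),(j,j+1)\in\Lambda$, and $K$ a subspace spanned by basis vectors other than $e_i,e_{i+1},e_j,e_{j+1}$, such that $\pi_{i(i+1)}(e_j^2)\notin\langle e_i-e_{i+1}\rangle$ or $\pi_{i(i+1)}(e_{j+1}^2)\notin\langle e_i-e_{i+1}\rangle$. Fix any natural basis $B_0$ of $\mathcal{E}$. Then $\mathcal{E}$ is modular if and only if no two consecutive terms of the derived series both fail to be basic ideals relative to $B_0$, and $(\ast)$ holds. Here $(\ast)$ may be read in either of two ways, and the equivalence is asserted for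 both: that $(\ast)$ holds for every natural basis in block form, or that there is a natural basis in block form for which $(\ast)$ holds. -/

import Mathlib

open Module

noncomputable section

namespace EvolutionAlgebra

variable {K E : Type*} [Field K] [NonUnitalNonAssocRing E] [Module K E]
  [IsScalarTower K E E] [SMulCommClass K E E] {n : ℕ}

/-- A natural basis: distinct basis vectors have product zero. A (finite-dimensional) evolution
algebra is an algebra that admits a natural basis. -/
def IsNaturalBasis (b : Basis (Fin n) K E) : Prop :=
  ∀ i j, i ≠ j → b i * b j = 0

/-- The structure matrix `(a_ik)` relative to `b`: `e_i ^ 2 = ∑ k, a_ik e_k`. -/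
def structureMatrix (b : Basis (Fin n) K E) : Matrix (Fin n) (Fin n) K :=
  Matrix.of fun i k => b.repr (b i * b i) k

variable (K E) in
/-- The terms of the derived series, numbered from `1`: `E^(1) = E` and `E^(k+1) = E^(k) E^(k)`,
the linear span of all products of two elements of `E^(k)`. The value at `0` is not used. -/
def derivedTerm : ℕ → Submodule K E
  | 0 => ⊤
  | 1 => ⊤
  | k + 2 => Submodule.map₂ (LinearMap.mul K E) (derivedTerm (k + 1)) (derivedTerm (k + 1))

variable (K E) in
/-- Some term of the derived series vanishes. -/
def IsSolvableAlgebra : Prop := ∃ m, 1 ≤ m ∧ derivedTerm K E m = ⊥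

variable (K E) in
/-- The least `m ≥ 1` with `E^(m) = 0`, for a solvable algebra. -/
def solvabilityIndex : ℕ := sInf {m | 1 ≤ m ∧ derivedTerm K E m = ⊥}

variable (K E) in
/-- Solvable with maximum index of solvability, which is `dim E + 1`. -/
def HasMaxSolvabilityIndex : Prop :=
  IsSolvableAlgebra K E ∧ solvabilityIndex K E = finrank K E + 1

/-- A basic ideal relative to `b`: a two-sided ideal which has a basis consisting of vectors
of `b` (possibly none of them, or all). -/
def IsBasicIdeal (b : Basis (Fin n) K E) (I : Submodule K E) : Prop :=
  (∀ x y, y ∈ I → x * y ∈ I ∧ y * x ∈ I) ∧ ∃ S : Set (Fin n), I = Submodule.span K (b '' S)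

/-- The derived series has no two consecutive terms that are not basic ideals. -/
def NoTwoConsecutiveNonBasic (b : Basis (Fin n) K E) : Prop :=
  ¬ ∃ m, 1 ≤ m ∧ ¬ IsBasicIdeal b (derivedTerm K E m) ∧
    ¬ IsBasicIdeal b (derivedTerm K E (m + 1))

/-- The set `Λ` of pairs `(i, i + 1)` at which the matrix has the block `(1, 1; -1, -1)`. -/
def blockPairs (M : Matrix (Fin n) (Fin n) K) : Set (Fin n × Fin n) :=
  {p | p.1.val + 1 = p.2.val ∧ M.submatrix ![p.1, p.2] ![p.1, p.2] = !![1, 1; -1, -1]}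

/-- The matrix is block lower triangular, each diagonal block being a `1 × 1` zero block or
the `2 × 2` block `(1, 1; -1, -1)`, and its rank is `n - 1`. The function `f` numbers the blocks:
`f i` is the block to which the index `i` belongs. (For `n = 0` both sides of the rank condition
are `0`.) -/
def HasBlockForm (M : Matrix (Fin n) (Fin n) K) : Prop :=
  (∃ f : Fin n → ℕ, Monotone f ∧ (∀ i j, f i < f j → M i j = 0) ∧
    ∀ i, ((∀ j, f j = f i ↔ j = i) ∧ M i i = 0) ∨
      ∃ p q, (p, q) ∈ blockPairs M ∧ (i = p ∨ i = q) ∧ ∀ j, f j = f i ↔ j = p ∨ j = q) ∧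
  M.rank = n - 1

/-- The linear projection `π_ij` onto `span {e_i, e_j}` along the other basis vectors (`i ≠ j`). -/
def pairProj (b : Basis (Fin n) K E) (i j : Fin n) : E →ₗ[K] E :=
  (b.coord i).smulRight (b i) + (b.coord j).smulRight (b j)

/-- There is a subalgebra `U = L + span {e_i - e_{i+1}, e_j ± e_{j+1}}` with `i < j`,
`(i, i+1), (j, j+1) ∈ Λ` and `L` spanned by basis vectors other than
`e_i, e_{i+1}, e_j, e_{j+1}`, such that `π_{i(i+1)} (e_j ^ 2)` or `π_{i(i+1)} (e_{j+1} ^ 2)` is not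
in the subalgebra generated by `e_i - e_{i+1}`. Here `i' = i + 1` and `j' = j + 1`. -/
def HasObstructingSubalgebra (b : Basis (Fin n) K E) : Prop :=
  ∃ (U : NonUnitalSubalgebra K E) (i i' j j' : Fin n) (S : Set (Fin n)) (ε : K),
    i < j ∧ (i, i') ∈ blockPairs (structureMatrix b) ∧ (j, j') ∈ blockPairs (structureMatrix b) ∧
    i ∉ S ∧ i' ∉ S ∧ j ∉ S ∧ j' ∉ S ∧ (ε = 1 ∨ ε = -1) ∧
    U.toSubmodule =
      Submodule.span K (b '' S) ⊔ Submodule.span K {b i - b i', b j + ε • b j'} ∧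
    (pairProj b i i' (b j * b j) ∉ NonUnitalAlgebra.adjoin K {b i - b i'} ∨
      pairProj b i i' (b j' * b j') ∉ NonUnitalAlgebra.adjoin K {b i - b i'})

end EvolutionAlgebra

end

/-!
The argument splits into two parts: one about the derived series, and one about the subalgebras of
an algebra whose natural basis is in block form.

Maximal index of solvability means that consecutive terms of the derived series differ by one
dimension (`derivedTerm_succ_covBy`). A term that is spanned by basis vectors is an ideal by
itself, and the next term is a hyperplane in it whose equation involves one or two coordinates only
(`derivedTerm_succ_shape`). If no two consecutive terms fail to be basic ideals, then after an
equation in two coordinates both of these coordinates disappear in the next term. Climbing the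
series from its end, and scaling the two basis vectors of each such step, gives a natural basis in
block form (`exists_hasBlockForm`).

Both conditions are necessary by the same pentagon (`exists_of_isModularLattice`): the products of
each of two vectors `c`, `c'` with itself and with the elements of a subalgebra `A` lie in `A`, and
a subalgebra `W` contains `A` and `c` but not `c'`. In a modular lattice everything in `W` that is
generated by `A`, `c`, `c'` lies in `A + ⟨c⟩`. Two consecutive terms that are not basic ideals
(`noTwoConsecutiveNonBasic_of_isModularLattice`) and an obstructing subalgebra
(`IsBlockNumbering.not_hasObstructingSubalgebra`) both contradict this; in both cases `c'` arises
from `c` by changing the sign of one coordinate.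

For the converse let the basis be in block form. The spans of the lower blocks are terms of the
derived series (`IsBlockNumbering.exists_below_eq_derivedTerm`), so some vector in the top block of
a subalgebra `U` has a square in the span of the lower blocks that is not a combination of products
of vectors from there, and this repeats block after block. Hence `U` is determined block by block:
below its top block it contains every `1 × 1` block and, in a pair, everything or the multiples of
`e_p - e_q`; in a pair at the top the multiples of `e_p + e_q` are possible as well
(`IsBlockNumbering.isRegular_or`). The sum of two subalgebras can fail to be a subalgebra only
where one of them has `e_p + e_q` and the other `e_p - e_q` in the same pair. There the squares
`e_p ^ 2`, `e_q ^ 2` could leave the sum only in a lower pair in which the former subalgebra is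
incomplete, and this produces an obstructing subalgebra (`IsBlockNumbering.pairSum_sq_eq_zero`). So
without obstructing subalgebras the join is the sum of subspaces (`IsBlockNumbering.mul_mem_sup`),
and the modular law of subspaces carries over.
-/

set_option linter.unusedSectionVars false
noncomputable section
namespace EvolutionAlgebra

variable {K E : Type*} [Field K] [NonUnitalNonAssocRing E] [Module K E]
  [IsScalarTower K E E] [SMulCommClass K E E] {n : ℕ}

/-! ### The derived series -/

theorem derivedTerm_succ {k : ℕ} (hk : 1 ≤ k) :
    derivedTerm K E (k + 1) =
      Submodule.map₂ (LinearMap.mul K E) (derivedTerm K E k) (derivedTerm K E k) := by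
  obtain ⟨k, rfl⟩ := Nat.exists_eq_add_of_le' hk
  rfl

theorem mul_mem_derivedTerm_succ {k : ℕ} (hk : 1 ≤ k) {x y : E} (hx : x ∈ derivedTerm K E k)
    (hy : y ∈ derivedTerm K E k) : x * y ∈ derivedTerm K E (k + 1) := by
  rw [derivedTerm_succ hk]
  exact Submodule.apply_mem_map₂ (LinearMap.mul K E) hx hy

theorem derivedTerm_succ_le_iff {k : ℕ} (hk : 1 ≤ k) {X : Submodule K E} :
    derivedTerm K E (k + 1) ≤ X ↔
      ∀ x ∈ derivedTerm K E k, ∀ y ∈ derivedTerm K E k, x * y ∈ X := by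
  rw [derivedTerm_succ hk, Submodule.map₂_le]
  rfl

theorem derivedTerm_succ_le {k : ℕ} (hk : 1 ≤ k) :
    derivedTerm K E (k + 1) ≤ derivedTerm K E k := by
  induction k, hk using Nat.le_induction with
  | base => exact le_top
  | succ k hk ih =>
    rw [derivedTerm_succ_le_iff (by omega)]
    exact fun x hx y hy => mul_mem_derivedTerm_succ hk (ih hx) (ih hy)

theorem derivedTerm_le {k l : ℕ} (hk : 1 ≤ k) (hkl : k ≤ l) :
    derivedTerm K E l ≤ derivedTerm K E k := by
  induction l, hkl using Nat.le_induction with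
  | base => exact le_rfl
  | succ l hl ih => exact (derivedTerm_succ_le (hk.trans hl)).trans ih

variable (K E) in
/-- A term of the derived series as a subalgebra. -/
def derivedSubalgebra (k : ℕ) (hk : 1 ≤ k) : NonUnitalSubalgebra K E :=
  { derivedTerm K E k with
    mul_mem' := fun hx hy => derivedTerm_succ_le hk (mul_mem_derivedTerm_succ hk hx hy) }

theorem derivedTerm_eq_of_succ_eq {k l : ℕ} (hk : 1 ≤ k) (hkl : k ≤ l)
    (h : derivedTerm K E (k + 1) = derivedTerm K E k) :
    derivedTerm K E l = derivedTerm K E k := by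
  induction l, hkl using Nat.le_induction with
  | base => rfl
  | succ l hl ih => rw [derivedTerm_succ (hk.trans hl), ih, ← derivedTerm_succ hk, h]

section MaxIndex

variable (hmax : HasMaxSolvabilityIndex K E) (b : Basis (Fin n) K E)
include hmax b

theorem derivedTerm_last : derivedTerm K E (n + 1) = ⊥ := by
  have h' : solvabilityIndex K E = n + 1 := by
    simpa [finrank_eq_card_basis b] using hmax.2
  rw [← h']
  exact (Nat.sInf_mem hmax.1).2

theorem derivedTerm_ne_bot {k : ℕ} (hk : 1 ≤ k) (hkn : k ≤ n) : derivedTerm K E k ≠ ⊥ := by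
  intro h
  have h' : solvabilityIndex K E = n + 1 := by
    simpa [finrank_eq_card_basis b] using hmax.2
  have : solvabilityIndex K E ≤ k := Nat.sInf_le ⟨hk, h⟩
  omega

theorem derivedTerm_succ_lt {k : ℕ} (hk : 1 ≤ k) (hkn : k ≤ n) :
    derivedTerm K E (k + 1) < derivedTerm K E k := by
  refine lt_of_le_of_ne (derivedTerm_succ_le hk) fun h => ?_
  have h' := derivedTerm_eq_of_succ_eq hk (by omega : k ≤ n + 1) h
  rw [derivedTerm_last hmax b] at h'
  exact derivedTerm_ne_bot hmax b hk hkn h'.symm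

theorem finrank_derivedTerm {k : ℕ} (hk : 1 ≤ k) (hkn : k ≤ n + 1) :
    finrank K (derivedTerm K E k) + k = n + 1 := by
  have := Module.Finite.of_basis b
  have hup : ∀ k, 1 ≤ k → k ≤ n + 1 → finrank K (derivedTerm K E k) + k ≤ n + 1 := by
    intro k hk
    induction k, hk using Nat.le_induction with
    | base =>
      intro _
      have : finrank K (derivedTerm K E 1) = n := by
        rw [show derivedTerm K E 1 = ⊤ from rfl, finrank_top, finrank_eq_card_basis b,
          Fintype.card_fin]
      omega
    | succ k hk ih =>
      intro hkn
      have := ih (by omega)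
      have := Submodule.finrank_lt_finrank_of_lt (derivedTerm_succ_lt hmax b hk (by omega))
      omega
  have hlow : ∀ j k, 1 ≤ k → k + j = n + 1 → j ≤ finrank K (derivedTerm K E k) := by
    intro j
    induction j with
    | zero => simp
    | succ j ih =>
      intro k hk hkj
      have := ih (k + 1) (by omega) (by omega)
      have := Submodule.finrank_lt_finrank_of_lt (derivedTerm_succ_lt hmax b hk (by omega))
      omega
  have := hup k hk hkn
  have := hlow (n + 1 - k) k hk (by omega)
  omega

/-- Consecutive terms differ by one dimension, because there are `n + 1` terms in all. -/
theorem derivedTerm_succ_covBy {k : ℕ} (hk : 1 ≤ k) (hkn : k ≤ n) :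
    derivedTerm K E (k + 1) ⋖ derivedTerm K E k := by
  have := Module.Finite.of_basis b
  refine ⟨derivedTerm_succ_lt hmax b hk hkn, fun X h1 h2 => ?_⟩
  have := Submodule.finrank_lt_finrank_of_lt h1
  have := Submodule.finrank_lt_finrank_of_lt h2
  have := finrank_derivedTerm hmax b hk (by omega)
  have := finrank_derivedTerm hmax b (by omega : 1 ≤ k + 1) (by omega)
  omega

theorem derivedTerm_succ_eq_of_le_of_lt {k : ℕ} (hk : 1 ≤ k) (hkn : k ≤ n) {X : Submodule K E}
    (h1 : derivedTerm K E (k + 1) ≤ X) (h2 : X < derivedTerm K E k) :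
    derivedTerm K E (k + 1) = X :=
  h1.eq_or_lt.resolve_right fun h => (derivedTerm_succ_covBy hmax b hk hkn).2 h h2

end MaxIndex

/-! ### Products and coordinates relative to a natural basis -/

section Natural

variable {b : Basis (Fin n) K E} (hb : IsNaturalBasis b)

theorem mem_span_image_iff (b : Basis (Fin n) K E) {S : Set (Fin n)} {x : E} :
    x ∈ Submodule.span K (b '' S) ↔ ∀ i, i ∉ S → b.repr x i = 0 := by
  rw [Basis.mem_span_image]
  constructor
  · intro h i hi
    by_contra h0
    exact hi (h (by simpa using h0))
  · intro h i hi
    by_contra h0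
    exact (by simpa using hi : b.repr x i ≠ 0) (h i h0)

include hb in
theorem mul_eq_sum (x y : E) :
    x * y = ∑ i, (b.repr x i * b.repr y i) • (b i * b i) := by
  conv_lhs => rw [← b.sum_repr x, ← b.sum_repr y]
  rw [Finset.sum_mul_sum]
  refine Finset.sum_congr rfl fun i _ => ?_
  rw [Finset.sum_eq_single i]
  · rw [smul_mul_smul_comm]
  · intro j _ hj
    rw [smul_mul_smul_comm, hb i j hj.symm, smul_zero]
  · simp

include hb in
theorem mul_comm_of_isNaturalBasis (x y : E) : x * y = y * x := by
  rw [mul_eq_sum hb, mul_eq_sum hb y x]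
  simp only [mul_comm]

include hb in
theorem mul_mem_of_forall {X : Submodule K E} {x y : E}
    (h : ∀ i, b.repr x i ≠ 0 → b.repr y i ≠ 0 → b i * b i ∈ X) : x * y ∈ X := by
  rw [mul_eq_sum hb]
  refine Submodule.sum_mem _ fun i _ => ?_
  by_cases hx : b.repr x i = 0
  · simp [hx]
  by_cases hy : b.repr y i = 0
  · simp [hy]
  exact X.smul_mem _ (h i hx hy)

include hb in
theorem basis_mul (x : E) (i : Fin n) : b i * x = b.repr x i • (b i * b i) := by
  rw [mul_eq_sum hb, Finset.sum_eq_single i]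
  · simp
  · intro j _ hj
    simp [hj.symm]
  · simp

include hb in
/-- A coordinate subspace that is a subalgebra is an ideal, since a product of two basis vectors
is nonzero only when they agree. -/
theorem isBasicIdeal_derivedTerm {k : ℕ} (hk : 1 ≤ k) {S : Set (Fin n)}
    (hS : derivedTerm K E k = Submodule.span K (b '' S)) : IsBasicIdeal b (derivedTerm K E k) := by
  have key : ∀ x y, y ∈ derivedTerm K E k → x * y ∈ derivedTerm K E k := by
    intro x y hy
    refine mul_mem_of_forall hb fun i _ hi => ?_
    have hiS : b i ∈ derivedTerm K E k := by
      rw [hS] at hy ⊢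
      refine Submodule.subset_span ⟨i, ?_, rfl⟩
      by_contra h
      exact hi ((mem_span_image_iff b).1 hy i h)
    exact derivedTerm_succ_le hk (mul_mem_derivedTerm_succ hk hiS hiS)
  refine ⟨fun x y hy => ⟨key x y hy, ?_⟩, S, hS⟩
  rw [mul_comm_of_isNaturalBasis hb]
  exact key x y hy

end Natural

/-- A subalgebra enlarged by one vector `c` that multiplies it, and itself, into it. -/
def extendBy (A : NonUnitalSubalgebra K E) (c : E) (hc : c * c ∈ A)
    (hcA : ∀ a ∈ A, c * a ∈ A ∧ a * c ∈ A) : NonUnitalSubalgebra K E :=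
  { A.toSubmodule ⊔ Submodule.span K {c} with
    mul_mem' := by
      intro x y hx hy
      obtain ⟨x, hxA, _, hs, rfl⟩ := Submodule.mem_sup.1 hx
      obtain ⟨y, hyA, _, ht, rfl⟩ := Submodule.mem_sup.1 hy
      obtain ⟨s, rfl⟩ := Submodule.mem_span_singleton.1 hs
      obtain ⟨t, rfl⟩ := Submodule.mem_span_singleton.1 ht
      refine (le_sup_left : A.toSubmodule ≤ A.toSubmodule ⊔ Submodule.span K {c}) ?_
      change (x + s • c) * (y + t • c) ∈ A
      rw [add_mul, mul_add, mul_add, mul_smul_comm, smul_mul_smul_comm, smul_mul_assoc]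
      exact add_mem (add_mem (mul_mem hxA hyA) (SMulMemClass.smul_mem t (hcA x hxA).2))
        (add_mem (SMulMemClass.smul_mem s (hcA y hyA).1) (SMulMemClass.smul_mem (s * t) hc)) }

theorem mem_extendBy {A : NonUnitalSubalgebra K E} {c : E} {hc : c * c ∈ A}
    {hcA : ∀ a ∈ A, c * a ∈ A ∧ a * c ∈ A} {x : E} :
    x ∈ extendBy A c hc hcA ↔ ∃ a ∈ A, ∃ s : K, x = a + s • c := by
  change x ∈ A.toSubmodule ⊔ Submodule.span K {c} ↔ _
  simp only [Submodule.mem_sup, Submodule.mem_span_singleton]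
  constructor
  · rintro ⟨a, ha, _, ⟨s, rfl⟩, rfl⟩
    exact ⟨a, ha, s, rfl⟩
  · rintro ⟨a, ha, s, rfl⟩
    exact ⟨a, ha, _, ⟨s, rfl⟩, rfl⟩

/-- Both failures of modularity come from one pentagon. Its sides are `A + ⟨c⟩ ≤ W` and
`A + ⟨c'⟩`; as `c'` lies outside `W`, the second side meets `W` in `A` only, so that everything in
`W` generated by the two sides has to lie in `A + ⟨c⟩`. -/
theorem exists_of_isModularLattice (hmod : IsModularLattice (NonUnitalSubalgebra K E))
    {A W : NonUnitalSubalgebra K E} {c c' : E} (hAW : A ≤ W) (hcW : c ∈ W) (hcW' : c' ∉ W)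
    (hc : c * c ∈ A) (hcA : ∀ a ∈ A, c * a ∈ A ∧ a * c ∈ A)
    (hc' : c' * c' ∈ A) (hcA' : ∀ a ∈ A, c' * a ∈ A ∧ a * c' ∈ A) {z : E} (hzW : z ∈ W)
    (hz : ∀ B : NonUnitalSubalgebra K E, A ≤ B → c ∈ B → c' ∈ B → z ∈ B) :
    ∃ a ∈ A, ∃ s : K, z = a + s • c := by
  set U := extendBy A c hc hcA
  set V := extendBy A c' hc' hcA'
  have hAU : A ≤ U := fun a ha => mem_extendBy.2 ⟨a, ha, 0, by simp⟩
  have hAV : A ≤ V := fun a ha => mem_extendBy.2 ⟨a, ha, 0, by simp⟩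
  have hcU : c ∈ U := mem_extendBy.2 ⟨0, zero_mem _, 1, by simp⟩
  have hcV : c' ∈ V := mem_extendBy.2 ⟨0, zero_mem _, 1, by simp⟩
  have hUW : U ≤ W := by
    intro x hx
    obtain ⟨a, ha, s, rfl⟩ := mem_extendBy.1 hx
    exact add_mem (hAW ha) (SMulMemClass.smul_mem s hcW)
  have hVW : V ⊓ W ≤ U := by
    rintro x ⟨hx, hxW⟩
    obtain ⟨a, ha, s, rfl⟩ := mem_extendBy.1 hx
    have hs : s • c' ∈ W := by simpa using sub_mem hxW (hAW ha)
    have : s = 0 := by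
      by_contra h0
      exact hcW' (by simpa [smul_smul, h0] using SMulMemClass.smul_mem s⁻¹ hs)
    simpa [this] using hAU ha
  have hzUV : z ∈ (U ⊔ V) ⊓ W :=
    ⟨hz _ (hAU.trans le_sup_left) ((le_sup_left : U ≤ U ⊔ V) hcU)
      ((le_sup_right : V ≤ U ⊔ V) hcV), hzW⟩
  exact mem_extendBy.1 (sup_le le_rfl hVW (hmod.sup_inf_le_assoc_of_le V hUW hzUV))

/-! ### Hyperplanes in coordinate terms of the derived series -/

section Shape

variable {b : Basis (Fin n) K E} (hb : IsNaturalBasis b) (hmax : HasMaxSolvabilityIndex K E)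

theorem basis_mem_of_eq_span {b : Basis (Fin n) K E} {X : Submodule K E} {S : Set (Fin n)}
    (hS : X = Submodule.span K (b '' S)) {i : Fin n} (hi : i ∈ S) : b i ∈ X :=
  hS ▸ Submodule.subset_span ⟨i, hi, rfl⟩

theorem repr_pair {b : Basis (Fin n) K E} {p q : Fin n} (hpq : p ≠ q) (s t : K) :
    b.repr (s • b p + t • b q) p = s ∧ b.repr (s • b p + t • b q) q = t := by
  simp [hpq, hpq.symm]

include hb in
theorem smul_add_smul_mul_self {p q : Fin n} (hpq : p ≠ q) (s t : K) :
    (s • b p + t • b q) * (s • b p + t • b q) = (s * s) • (b p * b p) + (t * t) • (b q * b q) := by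
  simp only [add_mul, mul_add, smul_mul_smul_comm, hb p q hpq, hb q p hpq.symm, smul_zero,
    zero_add, add_zero]

include hb hmax in
/-- The term after a coordinate term is a hyperplane of it that is given by one or two coordinates.
If three coordinates `s, t, u` occurred in its equation `h = 0`, then it would contain
`h_t e_s - h_s e_t` and `h_u e_s - h_s e_u`, whose product is a multiple of `e_s ^ 2`, and the next
term would not be smaller. -/
theorem derivedTerm_succ_shape {k : ℕ} (hk : 1 ≤ k) (hkn : k ≤ n) {S : Set (Fin n)}
    (hS : derivedTerm K E k = Submodule.span K (b '' S)) :
    (∃ p ∈ S, derivedTerm K E (k + 1) = Submodule.span K (b '' (S \ {p}))) ∨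
    ∃ p ∈ S, ∃ q ∈ S, p ≠ q ∧ k + 1 ≤ n ∧ ∃ α β : K, α ≠ 0 ∧ β ≠ 0 ∧
      ∀ x, x ∈ derivedTerm K E (k + 1) ↔
        x ∈ derivedTerm K E k ∧ α * b.repr x p + β * b.repr x q = 0 := by
  have hlt := derivedTerm_succ_lt hmax b hk hkn
  obtain ⟨x₀, hx₀, hx₀'⟩ := SetLike.exists_of_lt hlt
  obtain ⟨h, hh₀, hh⟩ := Submodule.exists_le_ker_of_notMem hx₀'
  have hker : derivedTerm K E (k + 1) = derivedTerm K E k ⊓ LinearMap.ker h := by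
    refine derivedTerm_succ_eq_of_le_of_lt hmax b hk hkn (le_inf hlt.le hh) ?_
    refine lt_of_le_of_ne inf_le_left fun he => hh₀ ?_
    rw [← he] at hx₀
    exact hx₀.2
  have hmem : ∀ x, x ∈ derivedTerm K E (k + 1) ↔ x ∈ derivedTerm K E k ∧ h x = 0 := by
    intro x
    rw [hker]
    rfl
  have hsum : ∀ x, h x = ∑ i, b.repr x i * h (b i) := by
    intro x
    conv_lhs => rw [← b.sum_repr x]
    simp only [map_sum, map_smul, smul_eq_mul]
  have hcoord : ∀ x, x ∈ derivedTerm K E k ↔ ∀ i, i ∉ S → b.repr x i = 0 := by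
    intro x
    rw [hS, mem_span_image_iff]
  obtain ⟨p, hp, hhp⟩ : ∃ p ∈ S, h (b p) ≠ 0 := by
    by_contra! hne
    refine hh₀ ((hsum x₀).trans (Finset.sum_eq_zero fun i _ => ?_))
    by_cases hi : i ∈ S
    · rw [hne i hi, mul_zero]
    · rw [(hcoord x₀).1 hx₀ i hi, zero_mul]
  by_cases h1 : ∀ s ∈ S, s ≠ p → h (b s) = 0
  · left
    refine ⟨p, hp, ?_⟩
    ext x
    have hx : x ∈ derivedTerm K E k → h x = b.repr x p * h (b p) := by
      intro hx
      rw [hsum, Fintype.sum_eq_single p]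
      intro i hi
      by_cases hiS : i ∈ S
      · rw [h1 i hiS hi, mul_zero]
      · rw [(hcoord x).1 hx i hiS, zero_mul]
    rw [hmem, mem_span_image_iff]
    constructor
    · rintro ⟨hx1, hx2⟩ i hi
      rw [hx hx1] at hx2
      by_cases hip : i = p
      · subst hip
        exact (mul_eq_zero.1 hx2).resolve_right hhp
      · exact (hcoord x).1 hx1 i fun hiS => hi ⟨hiS, hip⟩
    · intro hx1
      have hx2 := (hcoord x).2 fun i hi => hx1 i fun h' => hi h'.1
      refine ⟨hx2, ?_⟩
      rw [hx hx2, hx1 p (fun h' => h'.2 rfl), zero_mul]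
  push Not at h1
  obtain ⟨q, hq, hqp, hhq⟩ := h1
  have hvec : ∀ s ∈ S, ∀ t ∈ S, h (b t) • b s + (-h (b s)) • b t ∈ derivedTerm K E (k + 1) := by
    intro s hs t ht
    rw [hmem]
    refine ⟨add_mem (Submodule.smul_mem _ _ (basis_mem_of_eq_span hS hs))
      (Submodule.smul_mem _ _ (basis_mem_of_eq_span hS ht)), ?_⟩
    simp
    ring
  have hkn' : k + 1 ≤ n := by
    by_contra hlast
    obtain rfl : k = n := by omega
    have h0 := hvec p hp q hq
    rw [derivedTerm_last hmax b, Submodule.mem_bot] at h0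
    have := (repr_pair (b := b) hqp.symm (h (b q)) (-h (b p))).1
    rw [h0] at this
    exact hhq (by simpa using this.symm)
  right
  refine ⟨p, hp, q, hq, hqp.symm, hkn', h (b p), h (b q), hhp, hhq, ?_⟩
  by_cases h2 : ∀ s ∈ S, s ≠ p → s ≠ q → h (b s) = 0
  · intro x
    rw [hmem]
    refine and_congr_right fun hx => ?_
    rw [hsum, Fintype.sum_eq_add p q hqp.symm]
    · rw [mul_comm, mul_comm (b.repr x q)]
    · rintro i ⟨hip, hiq⟩
      by_cases hiS : i ∈ S
      · rw [h2 i hiS hip hiq, mul_zero]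
      · rw [(hcoord x).1 hx i hiS, zero_mul]
  exfalso
  push Not at h2
  obtain ⟨r, hr, hrp, hrq, hhr⟩ := h2
  refine (derivedTerm_succ_lt hmax b (by omega : 1 ≤ k + 1) hkn').not_ge ?_
  rw [derivedTerm_succ_le_iff hk]
  intro x hx y _
  refine mul_mem_of_forall hb fun i hi _ => ?_
  have hiS : i ∈ S := by
    by_contra hiS
    exact hi ((hcoord x).1 hx i hiS)
  have key : ∀ t ∈ S, ∀ u ∈ S, t ≠ u → i ≠ t → i ≠ u → h (b t) ≠ 0 → h (b u) ≠ 0 →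
      b i * b i ∈ derivedTerm K E (k + 1 + 1) := by
    intro t ht u hu htu hit hiu hht hhu
    have := mul_mem_derivedTerm_succ (by omega) (hvec i hiS t ht) (hvec i hiS u hu)
    have e : (h (b t) • b i + (-h (b i)) • b t) * (h (b u) • b i + (-h (b i)) • b u) =
        (h (b t) * h (b u)) • (b i * b i) := by
      simp only [add_mul, mul_add, smul_mul_smul_comm, hb i u hiu, hb t i hit.symm, hb t u htu,
        smul_zero, add_zero]
    rw [e] at this
    exact (Submodule.smul_mem_iff _ (mul_ne_zero hht hhu)).1 this
  by_cases hip : i = p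
  · subst hip
    exact key q hq r hr hrq.symm hqp.symm hrp.symm hhq hhr
  by_cases hiq : i = q
  · subst hiq
    exact key p hp r hr hrp.symm hqp hrq.symm hhp hhr
  exact key p hp q hq hqp.symm hip hiq hhp hhq

variable {k : ℕ} {S : Set (Fin n)} {p q : Fin n} {α β : K}
  (hk : 1 ≤ k) (hS : derivedTerm K E k = Submodule.span K (b '' S))
  (hp : p ∈ S) (hq : q ∈ S) (hpq : p ≠ q) (hα : α ≠ 0) (hβ : β ≠ 0)
  (hmem : ∀ x, x ∈ derivedTerm K E (k + 1) ↔
    x ∈ derivedTerm K E k ∧ α * b.repr x p + β * b.repr x q = 0)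

include hS hp hq hpq hmem in
theorem pair_vector_mem : β • b p + (-α) • b q ∈ derivedTerm K E (k + 1) := by
  rw [hmem, (repr_pair hpq _ _).1, (repr_pair hpq _ _).2]
  exact ⟨add_mem (Submodule.smul_mem _ _ (basis_mem_of_eq_span hS hp))
      (Submodule.smul_mem _ _ (basis_mem_of_eq_span hS hq)), by ring⟩

include hS hp hq hpq hβ hmem in
theorem span_diff_lt : Submodule.span K (b '' (S \ {p, q})) < derivedTerm K E (k + 1) := by
  refine lt_of_le_of_ne ?_ fun he => ?_
  · rw [Submodule.span_le]
    rintro _ ⟨s, ⟨hs, hs'⟩, rfl⟩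
    simp only [Set.mem_insert_iff, Set.mem_singleton_iff, not_or] at hs'
    refine (hmem _).2 ⟨basis_mem_of_eq_span hS hs, ?_⟩
    simp [hs'.1, hs'.2]
  · have h1 := pair_vector_mem hS hp hq hpq hmem
    rw [← he, mem_span_image_iff] at h1
    have := h1 p (by simp)
    rw [(repr_pair hpq _ _).1] at this
    exact hβ this

include hS hp hq hpq hα hβ hmem in
theorem ne_span_of_pair (S' : Set (Fin n)) :
    derivedTerm K E (k + 1) ≠ Submodule.span K (b '' S') := by
  intro h
  have h1 := pair_vector_mem hS hp hq hpq hmem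
  rw [h, mem_span_image_iff] at h1
  have hpS' : p ∈ S' := by
    by_contra hpS'
    have := h1 p hpS'
    rw [(repr_pair hpq _ _).1] at this
    exact hβ this
  have := ((hmem _).1 (basis_mem_of_eq_span h hpS')).2
  simp [hpq, hα] at this

include hb hk hS hpq hα hmem in
/-- Of the squares of the basis vectors in `S`, only those of `e_p` and `e_q` can be missing from
`E^(k + 2)`, and it contains a combination of these two with nonzero coefficients. So with `e_q ^ 2`
it would contain all the squares, and equal `E^(k + 1)`. -/
theorem not_mul_self_mem (hlt : derivedTerm K E (k + 1 + 1) < derivedTerm K E (k + 1))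
    (hp : p ∈ S) (hq : q ∈ S) (hβ : β ≠ 0) :
    b q * b q ∉ derivedTerm K E (k + 1 + 1) := by
  intro hqq
  refine hlt.not_ge ?_
  rw [derivedTerm_succ_le_iff hk]
  intro x hx y _
  refine mul_mem_of_forall hb fun i hi _ => ?_
  have hiS : i ∈ S := by
    by_contra hiS
    rw [hS, mem_span_image_iff] at hx
    exact hi (hx i hiS)
  by_cases hiq : i = q
  · rwa [hiq]
  by_cases hip : i = p
  · have h1 := pair_vector_mem hS hp hq hpq hmem
    have h2 := mul_mem_derivedTerm_succ (by omega) h1 h1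
    rw [smul_add_smul_mul_self hb hpq,
      Submodule.add_mem_iff_left _ (Submodule.smul_mem _ _ hqq)] at h2
    rw [hip]
    exact (Submodule.smul_mem_iff _ (mul_ne_zero hβ hβ)).1 h2
  have : b i ∈ derivedTerm K E (k + 1) :=
    (hmem _).2 ⟨basis_mem_of_eq_span hS hiS, by simp [hip, hiq]⟩
  exact mul_mem_derivedTerm_succ (by omega) this this

end Shape

/-! ### Modularity forbids consecutive terms that are not basic ideals -/

/-- If `E^(m - 1)` is a coordinate term and `E^(m)`, `E^(m + 1)` are not, then `E^(m)` is given in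
`E^(m - 1)` by an equation between two coordinates `p, q`. Let `E^(k)` be the last term not inside
`x_p = 0`. Changing the sign of the `q`-th coordinate of a suitable `c ∈ E^(k)` gives a vector
`c'` with the same square and the same products with `x_p = 0`; the pentagon of `c`, `c'` places
`e_q ^ 2` in `E^(k) ≤ E^(m + 1)`, which is impossible. -/
theorem noTwoConsecutiveNonBasic_of_isModularLattice (h2 : (2 : K) ≠ 0)
    {b : Basis (Fin n) K E} (hb : IsNaturalBasis b) (hmax : HasMaxSolvabilityIndex K E)
    (hmod : IsModularLattice (NonUnitalSubalgebra K E)) : NoTwoConsecutiveNonBasic b := by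
  intro hex
  classical
  have hmin := Nat.find_spec hex
  have hlow := fun l => Nat.find_min hex (m := l)
  generalize Nat.find hex = m at hmin hlow
  obtain ⟨hm, hm0, hm1⟩ := hmin
  have hm2 : m ≠ 1 := by
    rintro rfl
    refine hm0 (isBasicIdeal_derivedTerm hb le_rfl (S := Set.univ) ?_)
    rw [Set.image_univ, b.span_eq]
    rfl
  obtain ⟨k, rfl⟩ : ∃ k, m = k + 1 := ⟨m - 1, by omega⟩
  have hk : 1 ≤ k := by omega
  have hkb : IsBasicIdeal b (derivedTerm K E k) := by
    by_contra hkb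
    exact hlow k (by omega) ⟨hk, hkb, hm0⟩
  obtain ⟨S, hS⟩ := hkb.2
  have hkn : k ≤ n := by
    by_contra hkn
    refine hm0 (isBasicIdeal_derivedTerm hb (by omega) (S := ∅) ?_)
    rw [Set.image_empty, Submodule.span_empty, eq_bot_iff, ← derivedTerm_last hmax b]
    exact derivedTerm_le (by omega) (by omega)
  rcases derivedTerm_succ_shape hb hmax hk hkn hS with
    ⟨p, -, hp⟩ | ⟨p, hp, q, hq, hpq, hkn', α, β, hα, hβ, hmem⟩
  · exact hm0 (isBasicIdeal_derivedTerm hb (by omega) hp)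
  have hlt := derivedTerm_succ_lt hmax b (by omega : 1 ≤ k + 1) hkn'
  have hcoord : ∀ x ∈ derivedTerm K E (k + 1), ∀ i, i ∉ S → b.repr x i = 0 := by
    intro x hx
    rw [← mem_span_image_iff, ← hS]
    exact ((hmem x).1 hx).1
  have hq0 : ∀ x ∈ derivedTerm K E (k + 1), b.repr x p = 0 → b.repr x q = 0 := by
    intro x hx hxp
    have := ((hmem x).1 hx).2
    rw [hxp, mul_zero, zero_add] at this
    exact (mul_eq_zero.1 this).resolve_left hβ
  have hex' : ∃ x ∈ derivedTerm K E (k + 1 + 1), b.repr x p ≠ 0 := by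
    by_contra! hall
    refine hm1 (isBasicIdeal_derivedTerm hb (by omega) (S := S \ {p, q}) ?_)
    refine derivedTerm_succ_eq_of_le_of_lt hmax b (by omega) hkn' (fun x hx => ?_)
      (span_diff_lt hS hp hq hpq hβ hmem)
    rw [mem_span_image_iff]
    intro i hi
    by_cases hiS : i ∈ S
    · have : i = p ∨ i = q := by
        by_contra hne
        exact hi ⟨hiS, by simpa using hne⟩
      rcases this with rfl | rfl
      · exact hall x hx
      · exact hq0 x (hlt.le hx) (hall x hx)
    · exact hcoord x (hlt.le hx) i hiS
  obtain ⟨l, hl, ⟨c, hcl, hcp⟩, hnext⟩ : ∃ l, k + 1 + 1 ≤ l ∧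
      (∃ x ∈ derivedTerm K E l, b.repr x p ≠ 0) ∧
      ∀ x ∈ derivedTerm K E (l + 1), b.repr x p = 0 := by
    by_contra! hall
    have : ∀ l, k + 1 + 1 ≤ l → ∃ x ∈ derivedTerm K E l, b.repr x p ≠ 0 := by
      intro l hl
      induction l, hl using Nat.le_induction with
      | base => exact hex'
      | succ l hl ih => exact hall l hl ih
    obtain ⟨x, hx, hx0⟩ := this (k + n + 2) (by omega)
    have := derivedTerm_le (by omega) (by omega : n + 1 ≤ k + n + 2) hx
    rw [derivedTerm_last hmax b, Submodule.mem_bot] at this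
    exact hx0 (by simp [this])
  have hl1 : 1 ≤ l := by omega
  have hlk : derivedTerm K E l ≤ derivedTerm K E (k + 1) := derivedTerm_le (by omega) (by omega)
  let A : NonUnitalSubalgebra K E :=
    { (derivedTerm K E l ⊓ LinearMap.ker (b.coord p) : Submodule K E) with
      mul_mem' := by
        rintro x y ⟨hx, -⟩ ⟨hy, -⟩
        have := mul_mem_derivedTerm_succ hl1 hx hy
        exact ⟨derivedTerm_succ_le hl1 this, hnext _ this⟩ }
  have hA : ∀ x, x ∈ derivedTerm K E (l + 1) → x ∈ A := fun x hx =>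
    ⟨derivedTerm_succ_le hl1 hx, hnext x hx⟩
  set c' : E := c - (2 * b.repr c q) • b q with hc'
  have hcq : b.repr c q ≠ 0 := by
    intro h0
    have := ((hmem c).1 (hlk hcl)).2
    rw [h0, mul_zero, add_zero] at this
    exact hcp ((mul_eq_zero.1 this).resolve_left hα)
  have hcomm := mul_comm_of_isNaturalBasis hb
  have hcb : c * b q = b.repr c q • (b q * b q) := by rw [hcomm, basis_mul hb]
  have hsq : c' * c' = c * c := by
    simp only [hc', sub_mul, mul_sub, smul_mul_assoc, mul_smul_comm, hcb, hcomm (b q) c]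
    module
  have hc'a : ∀ a ∈ A, c' * a = c * a := by
    rintro a ⟨ha, hap⟩
    rw [hc', sub_mul, smul_mul_assoc, basis_mul hb, hq0 a (hlk ha) hap]
    simp
  have hca : ∀ a ∈ A, c * a ∈ A := fun a ha => hA _ (mul_mem_derivedTerm_succ hl1 hcl ha.1)
  have hbq : b q ∈ derivedTerm K E k := basis_mem_of_eq_span hS hq
  obtain ⟨a, ha, s, hz⟩ := exists_of_isModularLattice hmod (A := A)
    (W := derivedSubalgebra K E (k + 1) (by omega)) (c := c) (c' := c') (z := b q * b q)
    (fun x hx => hlk hx.1) (hlk hcl)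
    (by
      intro hW
      have h1 := ((hmem _).1 hW).2
      have h3 := ((hmem _).1 (hlk hcl)).2
      have h4 : b.repr c' p = b.repr c p := by simp [hc', hpq]
      have h5 : b.repr c' q = - b.repr c q := by
        simp [hc']
        ring
      rw [h4, h5] at h1
      have : 2 * (α * b.repr c p) = 0 := by linear_combination h1 + h3
      exact mul_ne_zero h2 (mul_ne_zero hα hcp) this)
    (hA _ (mul_mem_derivedTerm_succ hl1 hcl hcl))
    (fun a ha => ⟨hca a ha, hcomm a c ▸ hca a ha⟩)
    (hsq ▸ hA _ (mul_mem_derivedTerm_succ hl1 hcl hcl))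
    (fun a ha => ⟨hc'a a ha ▸ hca a ha, by rw [hcomm a c', hc'a a ha]; exact hca a ha⟩)
    (mul_mem_derivedTerm_succ hk hbq hbq)
    (by
      intro B _ hcB hc'B
      have h1 : (2 * b.repr c q) • b q ∈ B := by simpa [hc'] using sub_mem hcB hc'B
      have h3 : b q ∈ B := (Submodule.smul_mem_iff B.toSubmodule (mul_ne_zero h2 hcq)).1 h1
      exact mul_mem h3 h3)
  refine not_mul_self_mem hb hk hS hpq hα hmem hlt hp hq hβ ?_
  rw [hz]
  exact derivedTerm_le (by omega) hl (add_mem ha.1 (Submodule.smul_mem _ _ hcl))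

/-! ### Existence of a natural basis in block form -/

/-- The vectors `c 0, …, c (d - 1)` are pairwise orthogonal and multiply in block form. The function
`f` numbers the blocks: `f i` is the least index in the block of `i`, so that `f i ≤ i`. -/
structure IsBlockFamily (d : ℕ) (c : ℕ → E) (f : ℕ → ℕ) (K : Type*) [Field K] [Module K E] :
    Prop where
  orth : ∀ i < d, ∀ j < d, i ≠ j → c i * c j = 0
  mono : ∀ j < d, ∀ i ≤ j, f i ≤ f j
  le_self : ∀ i < d, f i ≤ i
  block : ∀ i < d, ((∀ j < d, f j = f i ↔ j = i) ∧
      c i * c i ∈ Submodule.span K (c '' {j | j < d ∧ f j < f i})) ∨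
    ∃ p, p + 1 < d ∧ (i = p ∨ i = p + 1) ∧ (∀ j < d, f j = f i ↔ j = p ∨ j = p + 1) ∧
      c p * c p - (c p + c (p + 1)) ∈ Submodule.span K (c '' {j | j < d ∧ f j < f i}) ∧
      c (p + 1) * c (p + 1) + (c p + c (p + 1)) ∈
        Submodule.span K (c '' {j | j < d ∧ f j < f i})

namespace IsBlockFamily

variable {d e : ℕ} {c c' : ℕ → E} {f f' : ℕ → ℕ}

/-- A block family extends by one further block, consisting of all indices `i` with
`d ≤ i < e`. -/
theorem extend (h : IsBlockFamily d c f K) (hde : d ≤ e) (hc : ∀ i < d, c' i = c i)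
    (hf : ∀ i < d, f' i = f i) (hf' : ∀ i, d ≤ i → f' i = d)
    (hnew : ∀ i, d ≤ i → i < e → ∀ j < e, i ≠ j → c' i * c' j = 0 ∧ c' j * c' i = 0)
    (hblock : (e = d + 1 ∧ c' d * c' d ∈ Submodule.span K (c '' {j | j < d})) ∨
      (e = d + 2 ∧ c' d * c' d - (c' d + c' (d + 1)) ∈ Submodule.span K (c '' {j | j < d}) ∧
        c' (d + 1) * c' (d + 1) + (c' d + c' (d + 1)) ∈ Submodule.span K (c '' {j | j < d}))) :
    IsBlockFamily e c' f' K := by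
  have hlt : ∀ i < d, f' i < d := fun i hi => hf i hi ▸ (h.le_self i hi).trans_lt hi
  have hspan : Submodule.span K (c '' {j | j < d}) ≤
      Submodule.span K (c' '' {j | j < e ∧ f' j < d}) := by
    refine Submodule.span_mono ?_
    rintro _ ⟨j, hj, rfl⟩
    exact ⟨j, ⟨hj.trans_le hde, hlt j hj⟩, hc j hj⟩
  refine ⟨fun i hi j hj hij => ?_, fun j hj i hij => ?_, fun i hi => ?_, fun i hi => ?_⟩
  · rcases lt_or_ge i d with hid | hid
    · rcases lt_or_ge j d with hjd | hjd
      · rw [hc i hid, hc j hjd]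
        exact h.orth i hid j hjd hij
      · exact (hnew j hjd hj i hi hij.symm).2
    · exact (hnew i hid hi j hj hij).1
  · rcases lt_or_ge j d with hjd | hjd
    · rw [hf j hjd, hf i (by omega)]
      exact h.mono j hjd i hij
    · rw [hf' j hjd]
      rcases lt_or_ge i d with hid | hid
      · exact (hlt i hid).le
      · exact (hf' i hid).le
  · rcases lt_or_ge i d with hid | hid
    · exact hf i hid ▸ h.le_self i hid
    · exact hf' i hid ▸ hid
  · rcases lt_or_ge i d with hid | hid
    · have hi' := h.le_self i hid
      have hiff : ∀ j < e, ∀ P : Prop, (d ≤ j → ¬ P) → (j < d → (f j = f i ↔ P)) →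
          (f' j = f' i ↔ P) := by
        intro j _ P h1 h2
        rcases lt_or_ge j d with hjd | hjd
        · rw [hf j hjd, hf i hid]
          exact h2 hjd
        · rw [hf' j hjd, hf i hid]
          exact iff_of_false (by omega) (h1 hjd)
      have hspan' : Submodule.span K (c '' {j | j < d ∧ f j < f i}) ≤
          Submodule.span K (c' '' {j | j < e ∧ f' j < f' i}) := by
        refine Submodule.span_mono ?_
        rintro _ ⟨j, ⟨hj, hj'⟩, rfl⟩
        exact ⟨j, ⟨hj.trans_le hde, by rwa [hf j hj, hf i hid]⟩, hc j hj⟩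
      rcases h.block i hid with ⟨h1, h2⟩ | ⟨p, hp, hip, h1, h2, h3⟩
      · refine Or.inl ⟨fun j hj => hiff j hj _ (by omega) (h1 j), ?_⟩
        rw [hc i hid]
        exact hspan' h2
      · refine Or.inr ⟨p, by omega, hip, fun j hj => hiff j hj _ (by omega) (h1 j), ?_⟩
        rw [hc p (by omega), hc (p + 1) hp]
        exact ⟨hspan' h2, hspan' h3⟩
    · have hiff : ∀ j < e, f' j = f' i ↔ d ≤ j := by
        intro j _
        rw [hf' i hid]
        rcases lt_or_ge j d with hjd | hjd
        · exact iff_of_false (hlt j hjd).ne (by omega)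
        · exact iff_of_true (hf' j hjd) hjd
      rcases hblock with ⟨rfl, h2⟩ | ⟨rfl, h2, h3⟩
      · obtain rfl : i = d := by omega
        refine Or.inl ⟨fun j hj => (hiff j hj).trans (by omega), ?_⟩
        rw [hf' i le_rfl]
        exact hspan h2
      · refine Or.inr ⟨d, by omega, by omega, fun j hj => (hiff j hj).trans (by omega), ?_⟩
        rw [hf' i hid]
        exact ⟨hspan h2, hspan h3⟩

end IsBlockFamily

section Existence

variable {b : Basis (Fin n) K E} (hb : IsNaturalBasis b) (hmax : HasMaxSolvabilityIndex K E)

theorem mul_eq_zero_of_notMem (hb : IsNaturalBasis b) {S : Set (Fin n)} {i : Fin n} (hi : i ∉ S)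
    {x : E} (hx : x ∈ Submodule.span K (b '' S)) : b i * x = 0 ∧ x * b i = 0 := by
  rw [mul_comm_of_isNaturalBasis hb x, basis_mul hb, (mem_span_image_iff b).1 hx i hi]
  simp

include hb hmax in
/-- The induction behind the existence of a basis in block form. It climbs the derived series from
its last term, along the coordinate terms, and scales the two basis vectors that are new when a term
has been skipped. -/
theorem exists_isBlockFamily (hno : NoTwoConsecutiveNonBasic b) (d : ℕ) :
    ∀ k, 1 ≤ k → k + d = n + 1 → ∀ S : Set (Fin n),
      derivedTerm K E k = Submodule.span K (b '' S) →
      ∃ (c : ℕ → E) (f : ℕ → ℕ), IsBlockFamily d c f K ∧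
        Submodule.span K (c '' {j | j < d}) = derivedTerm K E k := by
  induction d using Nat.strong_induction_on with
  | _ d ih =>
  intro k hk hkd S hS
  rcases Nat.eq_zero_or_pos d with rfl | hd
  · refine ⟨0, 0, ⟨by simp, by simp, by simp, by simp⟩, ?_⟩
    obtain rfl : k = n + 1 := by omega
    simp [derivedTerm_last hmax b]
  rcases derivedTerm_succ_shape hb hmax hk (by omega) hS with
    ⟨p, hp, hp'⟩ | ⟨p, hp, q, hq, hpq, hkn, α, β, hα, hβ, hmem⟩
  · obtain ⟨e, rfl⟩ : ∃ e, d = e + 1 := ⟨d - 1, by omega⟩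
    obtain ⟨c, f, hcf, hspan⟩ := ih e (by omega) (k + 1) (by omega) (by omega) _ hp'
    have hcmem : ∀ j < e, c j ∈ Submodule.span K (b '' (S \ {p})) := fun j hj =>
      hp' ▸ hspan ▸ Submodule.subset_span ⟨j, hj, rfl⟩
    set c' : ℕ → E := fun j => if j < e then c j else b p with hc'
    have hc1 : ∀ j < e, c' j = c j := fun j hj => if_pos hj
    have hc2 : c' e = b p := if_neg (lt_irrefl e)
    refine ⟨c', fun j => if j < e then f j else e, hcf.extend (by omega) hc1
      (fun j hj => if_pos hj) (fun j hj => if_neg (by omega)) ?_ (Or.inl ⟨rfl, ?_⟩), ?_⟩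
    · intro i hi hi' j hj hij
      obtain rfl : i = e := by omega
      rw [hc2, hc1 j (by omega)]
      exact mul_eq_zero_of_notMem hb (by simp) (hcmem j (by omega))
    · rw [hspan, hc2]
      have := basis_mem_of_eq_span hS hp
      exact mul_mem_derivedTerm_succ hk this this
    · have hlow : derivedTerm K E (k + 1) ≤ Submodule.span K (c' '' {j | j < e + 1}) := by
        rw [← hspan]
        refine Submodule.span_mono ?_
        rintro _ ⟨j, hj, rfl⟩
        exact ⟨j, Nat.lt_succ_of_lt hj, hc1 j hj⟩
      refine le_antisymm ?_ ?_
      · rw [Submodule.span_le]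
        rintro _ ⟨j, hj, rfl⟩
        rcases lt_or_ge j e with hje | hje
        · rw [hc1 j hje]
          exact derivedTerm_succ_le hk (hspan ▸ Submodule.subset_span ⟨j, hje, rfl⟩)
        · obtain rfl : j = e := by
            have : j < e + 1 := hj
            omega
          rw [hc2]
          exact basis_mem_of_eq_span hS hp
      · conv_lhs => rw [hS]
        rw [Submodule.span_le]
        rintro _ ⟨s, hs, rfl⟩
        by_cases hsp : s = p
        · rw [hsp]
          exact Submodule.subset_span ⟨e, Nat.lt_succ_self e, hc2⟩
        · exact hlow (basis_mem_of_eq_span hp' ⟨hs, hsp⟩)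
  · obtain ⟨e, rfl⟩ : ∃ e, d = e + 2 := ⟨d - 2, by omega⟩
    have hlt := span_diff_lt hS hp hq hpq hβ hmem
    set X := Submodule.span K (b '' (S \ {p, q})) with hX
    have hnext : derivedTerm K E (k + 1 + 1) = X := by
      have hnb : IsBasicIdeal b (derivedTerm K E (k + 1 + 1)) := by
        by_contra hnb
        refine hno ⟨k + 1, by omega, fun hb' => ?_, hnb⟩
        obtain ⟨S', hS'⟩ := hb'.2
        exact ne_span_of_pair hS hp hq hpq hα hβ hmem S' hS'
      obtain ⟨S', hS'⟩ := hnb.2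
      refine derivedTerm_succ_eq_of_le_of_lt hmax b (by omega) hkn ?_ hlt
      conv_lhs => rw [hS']
      rw [Submodule.span_le]
      rintro _ ⟨s, hs, rfl⟩
      obtain ⟨hsk, hs0⟩ := (hmem _).1
        (derivedTerm_succ_le (by omega) (basis_mem_of_eq_span hS' hs))
      refine Submodule.subset_span ⟨s, ⟨?_, ?_⟩, rfl⟩
      · by_contra hsS
        rw [hS, mem_span_image_iff] at hsk
        simpa using hsk s hsS
      · rintro (rfl | rfl)
        · simp [hpq, hα] at hs0
        · simp [hpq.symm, hβ] at hs0
    obtain ⟨c, f, hcf, hspan⟩ := ih e (by omega) (k + 1 + 1) (by omega) (by omega) _ hnext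
    have hcmem : ∀ j < e, c j ∈ X := fun j hj =>
      hnext ▸ hspan ▸ Submodule.subset_span ⟨j, hj, rfl⟩
    have hsq : ∀ s ∈ S, b s * b s ∈ derivedTerm K E (k + 1) := fun s hs =>
      mul_mem_derivedTerm_succ hk (basis_mem_of_eq_span hS hs) (basis_mem_of_eq_span hS hs)
    -- coordinates of the two squares, which determine the scaling
    have h1 := ((hmem _).1 (hsq p hp)).2
    have h2 := ((hmem _).1 (hsq q hq)).2
    have h3 : β * β * b.repr (b p * b p) p + α * α * b.repr (b q * b q) p = 0 := by
      have h1 := pair_vector_mem hS hp hq hpq hmem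
      have h2 := mul_mem_derivedTerm_succ (by omega) h1 h1
      rw [smul_add_smul_mul_self hb hpq, hnext, mem_span_image_iff] at h2
      simpa using h2 p (by simp)
    have hXk : ∀ x, x ∈ derivedTerm K E k → b.repr x p = 0 → b.repr x q = 0 → x ∈ X := by
      intro x hx hxp hxq
      rw [mem_span_image_iff]
      intro i hi
      by_cases hiS : i ∈ S
      · have : i = p ∨ i = q := by
          by_contra hne
          exact hi ⟨hiS, by simpa using hne⟩
        rcases this with rfl | rfl <;> assumption
      · rw [hS, mem_span_image_iff] at hx
        exact hx i hiS
    have hle := derivedTerm_succ_le (K := K) (E := E) hk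
    generalize hA : b.repr (b p * b p) p = A at h1 h3
    generalize hA' : b.repr (b p * b p) q = A' at h1
    generalize hB : b.repr (b q * b q) p = B at h2 h3
    generalize hB' : b.repr (b q * b q) q = B' at h2
    have hA0 : A ≠ 0 := by
      intro hA0
      have hB0 : B = 0 := by
        simpa [hA0, hα] using h3
      have hA0' : A' = 0 := by simpa [hA0, hβ] using h1
      have hB0' : B' = 0 := by simpa [hB0, hβ] using h2
      refine hlt.not_ge ?_
      rw [derivedTerm_succ_le_iff hk]
      intro x hx y _
      refine mul_mem_of_forall hb fun i hi _ => ?_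
      have hiS : i ∈ S := by
        by_contra hiS
        rw [hS, mem_span_image_iff] at hx
        exact hi (hx i hiS)
      by_cases hip : i = p
      · rw [hip]
        exact hXk _ (hle (hsq p hp)) (hA.trans hA0) (hA'.trans hA0')
      by_cases hiq : i = q
      · rw [hiq]
        exact hXk _ (hle (hsq q hq)) (hB.trans hB0) (hB'.trans hB0')
      have hik : b i ∈ derivedTerm K E (k + 1) :=
        hlt.le (basis_mem_of_eq_span hX ⟨hiS, by simp [hip, hiq]⟩)
      rw [← hnext]
      exact mul_mem_derivedTerm_succ (by omega) hik hik
    -- scaled so that the sum spans the line of the skipped term, and the first square is that sum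
    set u : K := A⁻¹ with hu
    set v : K := -(α / (β * A)) with hv
    have hu0 : u ≠ 0 := inv_ne_zero hA0
    have hv0 : v ≠ 0 := by
      rw [hv]
      exact neg_ne_zero.2 (div_ne_zero hα (mul_ne_zero hβ hA0))
    set c' : ℕ → E := fun j => if j < e then c j else if j = e then u • b p else v • b q with hc'
    have hc1 : ∀ j < e, c' j = c j := fun j hj => if_pos hj
    have hc2 : c' e = u • b p := by simp [hc']
    have hc3 : c' (e + 1) = v • b q := by simp [hc']
    have hpk := basis_mem_of_eq_span hS hp
    have hqk := basis_mem_of_eq_span hS hq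
    have hX0 : ∀ x ∈ X, (b p * x = 0 ∧ x * b p = 0) ∧ b q * x = 0 ∧ x * b q = 0 := fun x hx =>
      ⟨mul_eq_zero_of_notMem hb (by simp) hx, mul_eq_zero_of_notMem hb (by simp) hx⟩
    refine ⟨c', fun j => if j < e then f j else e, hcf.extend (by omega) hc1
      (fun j hj => if_pos hj) (fun j hj => if_neg (by omega)) ?_ (Or.inr ⟨rfl, ?_, ?_⟩), ?_⟩
    · intro i hi hi' j hj hij
      obtain rfl | rfl : i = e ∨ i = e + 1 := by omega
      · obtain hje | rfl : j < i ∨ j = i + 1 := by omega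
        · rw [hc2, hc1 j hje]
          obtain ⟨h5, h6⟩ := (hX0 _ (hcmem j hje)).1
          simp only [smul_mul_assoc, mul_smul_comm, h5, h6, smul_zero, and_self]
        · rw [hc2, hc3]
          simp only [smul_mul_smul_comm, hb p q hpq, hb q p hpq.symm, smul_zero, and_self]
      · obtain hje | rfl : j < e ∨ j = e := by omega
        · rw [hc3, hc1 j hje]
          obtain ⟨h5, h6⟩ := (hX0 _ (hcmem j hje)).2
          simp only [smul_mul_assoc, mul_smul_comm, h5, h6, smul_zero, and_self]
        · rw [hc2, hc3]
          simp only [smul_mul_smul_comm, hb p q hpq, hb q p hpq.symm, smul_zero, and_self]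
    · rw [hspan, hnext, hc2, hc3, smul_mul_smul_comm]
      refine hXk _ (sub_mem (Submodule.smul_mem _ _ (hle (hsq p hp)))
        (add_mem (Submodule.smul_mem _ _ hpk) (Submodule.smul_mem _ _ hqk))) ?_ ?_
      · rw [map_sub, Finsupp.sub_apply, (repr_pair hpq _ _).1]
        simp only [map_smul, Finsupp.smul_apply, smul_eq_mul, hA, hu]
        field_simp
        ring
      · rw [map_sub, Finsupp.sub_apply, (repr_pair hpq _ _).2]
        simp only [map_smul, Finsupp.smul_apply, smul_eq_mul, hA', hu, hv]
        field_simp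
        linear_combination h1
    · rw [hspan, hnext, hc2, hc3, smul_mul_smul_comm]
      refine hXk _ (add_mem (Submodule.smul_mem _ _ (hle (hsq q hq)))
        (add_mem (Submodule.smul_mem _ _ hpk) (Submodule.smul_mem _ _ hqk))) ?_ ?_
      · rw [map_add, Finsupp.add_apply, (repr_pair hpq _ _).1]
        simp only [map_smul, Finsupp.smul_apply, smul_eq_mul, hB, hu, hv]
        field_simp
        linear_combination h3
      · rw [map_add, Finsupp.add_apply, (repr_pair hpq _ _).2]
        simp only [map_smul, Finsupp.smul_apply, smul_eq_mul, hB', hv]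
        have h4 : α * B' = β * A :=
          mul_left_cancel₀ hβ (by linear_combination α * h2 - h3)
        field_simp
        linear_combination α * h4
    · have hlow : derivedTerm K E (k + 1 + 1) ≤ Submodule.span K (c' '' {j | j < e + 2}) := by
        rw [← hspan]
        refine Submodule.span_mono ?_
        rintro _ ⟨j, hj, rfl⟩
        exact ⟨j, Nat.lt_add_right 2 hj, hc1 j hj⟩
      refine le_antisymm ?_ ?_
      · rw [Submodule.span_le]
        rintro _ ⟨j, hj, rfl⟩
        obtain hje | rfl | rfl : j < e ∨ j = e ∨ j = e + 1 := by
          have : j < e + 2 := hj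
          omega
        · rw [hc1 j hje]
          exact hle (hlt.le (hcmem j hje))
        · rw [hc2]
          exact Submodule.smul_mem _ _ hpk
        · rw [hc3]
          exact Submodule.smul_mem _ _ hqk
      · conv_lhs => rw [hS]
        rw [Submodule.span_le]
        rintro _ ⟨s, hs, rfl⟩
        by_cases hsp : s = p
        · rw [hsp]
          exact (Submodule.smul_mem_iff _ hu0).1
            (Submodule.subset_span ⟨e, by simp, hc2⟩)
        by_cases hsq : s = q
        · rw [hsq]
          exact (Submodule.smul_mem_iff _ hv0).1
            (Submodule.subset_span ⟨e + 1, by simp, hc3⟩)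
        exact hlow (basis_mem_of_eq_span hnext ⟨hs, by simp [hsp, hsq]⟩)

include hmax in
theorem rank_structureMatrix {c : Basis (Fin n) K E} (hc : IsNaturalBasis c) :
    (structureMatrix c).rank = n - 1 := by
  have hrow : Submodule.map c.equivFun.toLinearMap (derivedTerm K E 2) =
      Submodule.span K (Set.range (structureMatrix c).row) := by
    have h1 : derivedTerm K E 2 = Submodule.span K (Set.range fun i => c i * c i) := by
      refine le_antisymm ?_ (Submodule.span_le.2 ?_)
      · rw [derivedTerm_succ_le_iff le_rfl]
        exact fun x _ y _ => mul_mem_of_forall hc fun i _ _ => Submodule.subset_span ⟨i, rfl⟩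
      · rintro _ ⟨i, rfl⟩
        exact mul_mem_derivedTerm_succ le_rfl Submodule.mem_top Submodule.mem_top
    rw [h1, Submodule.map_span, ← Set.range_comp]
    rfl
  rw [Matrix.rank_eq_finrank_span_row, ← hrow, LinearEquiv.finrank_map_eq]
  rcases Nat.eq_zero_or_pos n with rfl | hn
  · have := Module.Finite.of_basis c
    have := Submodule.finrank_le (derivedTerm K E 2)
    rwa [finrank_eq_card_basis c, Fintype.card_fin, Nat.le_zero] at this
  · have := finrank_derivedTerm hmax c (by omega : 1 ≤ 2) (by omega)
    omega

include hb hmax in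
theorem exists_hasBlockForm (hno : NoTwoConsecutiveNonBasic b) :
    ∃ c : Basis (Fin n) K E, IsNaturalBasis c ∧ HasBlockForm (structureMatrix c) := by
  obtain ⟨c, f, hcf, hspan⟩ := exists_isBlockFamily hb hmax hno n 1 le_rfl (by omega) Set.univ
    (by rw [Set.image_univ, b.span_eq]; rfl)
  have hrange : Set.range (fun i : Fin n => c i) = c '' {j | j < n} := by
    ext x
    constructor
    · rintro ⟨i, rfl⟩
      exact ⟨i, i.2, rfl⟩
    · rintro ⟨i, hi, rfl⟩
      exact ⟨⟨i, hi⟩, rfl⟩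
  let c' : Basis (Fin n) K E := basisOfTopLeSpanOfCardEqFinrank (fun i : Fin n => c i)
    (by rw [hrange, hspan]; exact le_rfl) (finrank_eq_card_basis b).symm
  have hc' : ∀ i, c' i = c i := fun i => by simp [c']
  have hnat : IsNaturalBasis c' := fun i j hij => by
    rw [hc', hc']
    exact hcf.orth i i.2 j j.2 fun h => hij (Fin.ext h)
  have hlow : ∀ i : Fin n, ∀ x ∈ Submodule.span K (c '' {j | j < n ∧ f j < f i}),
      ∀ j : Fin n, f i ≤ f j → c'.repr x j = 0 := by
    intro i x hx j hij
    refine (mem_span_image_iff c' (S := {j | f j < f i})).1 ?_ j (not_lt.2 hij)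
    refine Submodule.span_mono ?_ hx
    rintro _ ⟨l, ⟨hl, hl'⟩, rfl⟩
    exact ⟨⟨l, hl⟩, hl', hc' _⟩
  have hrep : ∀ i j : Fin n, c'.repr (c i) j = if i = j then 1 else 0 := by
    intro i j
    rw [← hc' i, c'.repr_self, Finsupp.single_apply]
  have hsq : ∀ i : Fin n, (∀ j : Fin n, f i < f j → c'.repr (c' i * c' i) j = 0) ∧
      (((∀ j : Fin n, f j = f i ↔ j = i) ∧ c'.repr (c' i * c' i) i = 0) ∨
      ∃ p q, (p, q) ∈ blockPairs (structureMatrix c') ∧ (i = p ∨ i = q) ∧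
        ∀ j : Fin n, f j = f i ↔ j = p ∨ j = q) := by
    intro i
    rcases hcf.block i i.2 with ⟨h0, h1⟩ | ⟨p, hp, hip, h0, h1, h2⟩
    · refine ⟨fun j hij => ?_, Or.inl ⟨fun j => (h0 j j.2).trans Fin.ext_iff.symm, ?_⟩⟩
      · rw [hc']
        exact hlow i _ h1 j hij.le
      · rw [hc']
        exact hlow i _ h1 i le_rfl
    · have hfp : f p = f i := (h0 p (by omega)).2 (Or.inl rfl)
      have hfq : f (p + 1) = f i := (h0 (p + 1) hp).2 (Or.inr rfl)
      let P : Fin n := ⟨p, by omega⟩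
      let Q : Fin n := ⟨p + 1, hp⟩
      have hPQ : P ≠ Q := fun h => by simp [P, Q] at h
      have e1 : ∀ j : Fin n, f i ≤ f j → c'.repr (c' P * c' P) j =
          (if P = j then 1 else 0) + if Q = j then 1 else 0 := by
        intro j hij
        have := hlow i _ h1 j hij
        rw [map_sub, map_add, Finsupp.sub_apply, Finsupp.add_apply, hrep P, hrep Q,
          sub_eq_zero] at this
        rw [hc', this]
      have e2 : ∀ j : Fin n, f i ≤ f j → c'.repr (c' Q * c' Q) j =
          -((if P = j then 1 else 0) + if Q = j then 1 else 0) := by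
        intro j hij
        have := hlow i _ h2 j hij
        rw [map_add, map_add, Finsupp.add_apply, Finsupp.add_apply, hrep P, hrep Q] at this
        rw [hc', eq_neg_of_add_eq_zero_left this]
      have hne : ∀ j : Fin n, f i < f j → P ≠ j ∧ Q ≠ j := by
        intro j hij
        constructor
        · rintro rfl
          exact hij.ne' hfp
        · rintro rfl
          exact hij.ne' hfq
      have hiPQ : i = P ∨ i = Q := by
        simpa [P, Q, Fin.ext_iff] using hip
      refine ⟨fun j hij => ?_, Or.inr ⟨P, Q, ⟨rfl, ?_⟩, hiPQ, fun j => ?_⟩⟩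
      · have e1 := e1 j hij.le
        have e2 := e2 j hij.le
        obtain ⟨h3, h4⟩ := hne j hij
        rw [if_neg h3, if_neg h4, add_zero] at e1 e2
        rcases hiPQ with h | h
        · rw [h, e1]
        · rw [h, e2, neg_zero]
      · have a1 := e1 P hfp.ge
        have a2 := e1 Q hfq.ge
        have a3 := e2 P hfp.ge
        have a4 := e2 Q hfq.ge
        simp only [hPQ, hPQ.symm, if_true, if_false, add_zero, zero_add] at a1 a2 a3 a4
        ext x y
        fin_cases x <;> fin_cases y
        · exact a1
        · exact a2
        · exact a3
        · exact a4
      · rw [h0 j j.2]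
        simp [P, Q, Fin.ext_iff]
  exact ⟨c', hnat, ⟨fun i => f i, fun i j hij => hcf.mono j j.2 i hij, fun i j => (hsq i).1 j,
    fun i => (hsq i).2⟩, rank_structureMatrix hmax hnat⟩

end Existence

/-! ### Algebras in block form -/

/-- The indices of `b` are numbered by `f` as the block form of the structure matrix asks for; the
rank condition is left out, as it follows from the maximal index of solvability. -/
structure IsBlockNumbering (b : Basis (Fin n) K E) (f : Fin n → ℕ) : Prop where
  mono : Monotone f
  triangular : ∀ i j, f i < f j → b.repr (b i * b i) j = 0
  block : ∀ i, ((∀ j, f j = f i ↔ j = i) ∧ b.repr (b i * b i) i = 0) ∨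
    ∃ p q, (p, q) ∈ blockPairs (structureMatrix b) ∧ (i = p ∨ i = q) ∧
      ∀ j, f j = f i ↔ j = p ∨ j = q

/-- The index `i` forms a `1 × 1` block. -/
def IsSingle (b : Basis (Fin n) K E) (f : Fin n → ℕ) (i : Fin n) : Prop :=
  (∀ j, f j = f i ↔ j = i) ∧ b.repr (b i * b i) i = 0

/-- The span of the blocks with number less than `t`. -/
def below (b : Basis (Fin n) K E) (f : Fin n → ℕ) (t : ℕ) : Submodule K E :=
  Submodule.span K (b '' {i | f i < t})

theorem mem_below {b : Basis (Fin n) K E} {f : Fin n → ℕ} {t : ℕ} {x : E} :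
    x ∈ below b f t ↔ ∀ i, t ≤ f i → b.repr x i = 0 := by
  rw [below, mem_span_image_iff]
  simp

theorem basis_mem_below {b : Basis (Fin n) K E} {f : Fin n → ℕ} {t : ℕ} {i : Fin n}
    (h : f i < t) : b i ∈ below b f t :=
  Submodule.subset_span ⟨i, h, rfl⟩

theorem below_mono (b : Basis (Fin n) K E) (f : Fin n → ℕ) {s t : ℕ} (h : s ≤ t) :
    below b f s ≤ below b f t := fun _ hx =>
  mem_below.2 fun i hi => mem_below.1 hx i (h.trans hi)

theorem below_succ_eq_below {b : Basis (Fin n) K E} {f : Fin n → ℕ} {t : ℕ}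
    (h : ∀ i, f i ≠ t) : below b f (t + 1) = below b f t := by
  ext x
  rw [mem_below, mem_below]
  exact forall_congr' fun i => by
    have := h i
    rw [show t + 1 ≤ f i ↔ t ≤ f i by omega]

theorem le_of_below_eq (hmax : HasMaxSolvabilityIndex K E)
    {b : Basis (Fin n) K E} {f : Fin n → ℕ} {k : ℕ} {i : Fin n} {t : ℕ} (hi : f i < t)
    (hV : below b f t = derivedTerm K E k) : k ≤ n := by
  by_contra hk
  have h1 := basis_mem_below (b := b) hi
  rw [hV] at h1
  have h3 := derivedTerm_le (by omega) (by omega : n + 1 ≤ k) h1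
  rw [derivedTerm_last hmax b, Submodule.mem_bot] at h3
  have := congrArg (fun x => b.repr x i) h3
  simp at this

/-- The span of the products of two elements of `below b f t`. -/
def belowSq (b : Basis (Fin n) K E) (f : Fin n → ℕ) (t : ℕ) : Submodule K E :=
  Submodule.map₂ (LinearMap.mul K E) (below b f t) (below b f t)

theorem mul_mem_belowSq {b : Basis (Fin n) K E} {f : Fin n → ℕ} {t : ℕ} {x y : E}
    (hx : x ∈ below b f t) (hy : y ∈ below b f t) : x * y ∈ belowSq b f t :=
  Submodule.apply_mem_map₂ (LinearMap.mul K E) hx hy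

section Entries

variable {b : Basis (Fin n) K E} {p q : Fin n}

theorem entries_of_mem_blockPairs (h : (p, q) ∈ blockPairs (structureMatrix b)) :
    p ≠ q ∧ (b.repr (b p * b p) p = 1 ∧ b.repr (b p * b p) q = 1) ∧
      b.repr (b q * b q) p = -1 ∧ b.repr (b q * b q) q = -1 := by
  obtain ⟨h1, h2⟩ := h
  refine ⟨?_, ⟨congrFun (congrFun h2 0) 0, congrFun (congrFun h2 0) 1⟩,
    congrFun (congrFun h2 1) 0, congrFun (congrFun h2 1) 1⟩
  rintro rfl
  simp at h1

end Entries

namespace IsBlockNumbering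

variable {b : Basis (Fin n) K E} {f : Fin n → ℕ} {p q : Fin n}

theorem of_hasBlockForm (h : HasBlockForm (structureMatrix b)) : ∃ f, IsBlockNumbering b f :=
  let ⟨⟨f, h1, h3, h4⟩, _⟩ := h
  ⟨f, h1, h3, h4⟩

variable (H : IsBlockNumbering b f)
include H

theorem mul_self_mem_below {i : Fin n} {t : ℕ} (hi : f i < t) : b i * b i ∈ below b f t :=
  mem_below.2 fun j hj => H.triangular i j (hi.trans_le hj)

/-- The pairs that show the block `(1, 1; -1, -1)` are blocks of the numbering. -/
theorem eq_iff (h2 : (2 : K) ≠ 0) (hpq : (p, q) ∈ blockPairs (structureMatrix b)) (j : Fin n) :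
    f j = f p ↔ j = p ∨ j = q := by
  obtain ⟨-, ⟨h11, -⟩, -⟩ := entries_of_mem_blockPairs hpq
  rcases H.block p with ⟨-, h0⟩ | ⟨p', q', hpq', rfl | rfl, h⟩
  · rw [h0] at h11
    exact absurd h11 zero_ne_one
  · have : q' = q := Fin.ext (hpq'.1.symm.trans hpq.1)
    rw [h j, this]
  · obtain ⟨-, -, -, h22⟩ := entries_of_mem_blockPairs hpq'
    rw [h22] at h11
    exact absurd (by linear_combination -h11 : (2 : K) = 0) h2

theorem eq_snd (h2 : (2 : K) ≠ 0) (hpq : (p, q) ∈ blockPairs (structureMatrix b)) : f q = f p :=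
  (H.eq_iff h2 hpq q).2 (Or.inr rfl)

theorem isSingle_or (i : Fin n) : IsSingle b f i ∨
    ∃ p q, (p, q) ∈ blockPairs (structureMatrix b) ∧ (i = p ∨ i = q) :=
  (H.block i).imp id fun ⟨p, q, h, hi, _⟩ => ⟨p, q, h, hi⟩

theorem ne_of_isSingle (h2 : (2 : K) ≠ 0) {i : Fin n} (hi : IsSingle b f i)
    (hpq : (p, q) ∈ blockPairs (structureMatrix b)) : f i ≠ f p := by
  intro h
  have h3 := (hi.1 p).1 h.symm
  have h4 := (hi.1 q).1 ((H.eq_snd h2 hpq).trans h.symm)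
  exact (entries_of_mem_blockPairs hpq).1 (h3.trans h4.symm)

theorem eq_and_eq (h2 : (2 : K) ≠ 0) {p' q' : Fin n}
    (hpq : (p, q) ∈ blockPairs (structureMatrix b))
    (hpq' : (p', q') ∈ blockPairs (structureMatrix b)) (h : f p' = f p) : p' = p ∧ q' = q := by
  have hp : p' = p := by
    rcases (H.eq_iff h2 hpq p').1 h with h | rfl
    · exact h
    · obtain ⟨-, ⟨h11, -⟩, -⟩ := entries_of_mem_blockPairs hpq'
      obtain ⟨-, -, -, h22⟩ := entries_of_mem_blockPairs hpq
      rw [h22] at h11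
      exact absurd (by linear_combination -h11 : (2 : K) = 0) h2
  subst hp
  exact ⟨rfl, Fin.ext (hpq'.1.symm.trans hpq.1)⟩

/-- A sum over the indices lies in a subspace if its part over each block does. -/
theorem sum_mem (h2 : (2 : K) ≠ 0) {X : Submodule K E} {g : Fin n → E}
    (h1 : ∀ i, IsSingle b f i → g i ∈ X)
    (hp : ∀ p q, (p, q) ∈ blockPairs (structureMatrix b) → g p + g q ∈ X) : ∑ i, g i ∈ X := by
  rw [← Finset.sum_fiberwise_of_maps_to (s := Finset.univ) (t := Finset.univ.image f) (g := f)
    (fun i hi => Finset.mem_image_of_mem f hi)]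
  refine Submodule.sum_mem _ fun t ht => ?_
  obtain ⟨i, -, rfl⟩ := Finset.mem_image.1 ht
  rcases H.isSingle_or i with hi | ⟨p, q, hpq, hi⟩
  · have : Finset.univ.filter (fun j => f j = f i) = {i} := by
      ext j
      simp [hi.1 j]
    rw [this, Finset.sum_singleton]
    exact h1 i hi
  · have : Finset.univ.filter (fun j => f j = f i) = {p, q} := by
      ext j
      have hip : f i = f p := (H.eq_iff h2 hpq i).2 hi
      simp [hip, H.eq_iff h2 hpq j]
    rw [this, Finset.sum_pair (entries_of_mem_blockPairs hpq).1]
    exact hp p q hpq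

theorem mem_of_blocks (h2 : (2 : K) ≠ 0) {X : Submodule K E} {x : E}
    (h1 : ∀ i, IsSingle b f i → b.repr x i ≠ 0 → b i ∈ X)
    (hp : ∀ p q, (p, q) ∈ blockPairs (structureMatrix b) → (b.repr x p ≠ 0 ∨ b.repr x q ≠ 0) →
      b.repr x p • b p + b.repr x q • b q ∈ X) : x ∈ X := by
  rw [← b.sum_repr x]
  refine H.sum_mem h2 (fun i hi => ?_) fun p q hpq => ?_
  · by_cases h0 : b.repr x i = 0
    · simp [h0]
    · exact X.smul_mem _ (h1 i hi h0)
  · by_cases h0 : b.repr x p ≠ 0 ∨ b.repr x q ≠ 0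
    · exact hp p q hpq h0
    · push Not at h0
      simp [h0]

section Products

variable (hb : IsNaturalBasis b)

theorem exists_single_add {i : Fin n} (hi : IsSingle b f i) {x : E}
    (hx : x ∈ below b f (f i + 1)) : ∃ v ∈ below b f (f i), x = b.repr x i • b i + v := by
  refine ⟨x - b.repr x i • b i, mem_below.2 fun j hj => ?_, by abel⟩
  by_cases hji : j = i
  · simp [hji]
  · have : f j ≠ f i := fun h => hji ((hi.1 j).1 h)
    simp [mem_below.1 hx j (by omega), Ne.symm hji]

theorem exists_pair_add (h2 : (2 : K) ≠ 0) (hpq : (p, q) ∈ blockPairs (structureMatrix b)) {x : E}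
    (hx : x ∈ below b f (f p + 1)) :
    ∃ v ∈ below b f (f p), x = b.repr x p • b p + b.repr x q • b q + v := by
  have hne := (entries_of_mem_blockPairs hpq).1
  refine ⟨x - (b.repr x p • b p + b.repr x q • b q), mem_below.2 fun j hj => ?_, by abel⟩
  rw [map_sub, Finsupp.sub_apply]
  by_cases hjp : j = p
  · rw [hjp, (repr_pair hne _ _).1, sub_self]
  by_cases hjq : j = q
  · rw [hjq, (repr_pair hne _ _).2, sub_self]
  have : f j ≠ f p := fun h => ((H.eq_iff h2 hpq j).1 h).elim hjp hjq
  simp [mem_below.1 hx j (by omega), Ne.symm hjp, Ne.symm hjq]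

include hb

theorem mul_mem_below {t : ℕ} {x : E} (y : E) (hx : x ∈ below b f t) : x * y ∈ below b f t := by
  refine mul_mem_of_forall hb fun i hi _ => H.mul_self_mem_below ?_
  by_contra h
  exact hi (mem_below.1 hx i (not_lt.1 h))

theorem basis_mul_below {i : Fin n} {t : ℕ} (hi : t ≤ f i) {v : E} (hv : v ∈ below b f t) :
    b i * v = 0 ∧ v * b i = 0 :=
  mul_eq_zero_of_notMem hb (S := {i | f i < t}) (not_lt.2 hi) hv

theorem single_mul_single {i : Fin n} {v w : E} (hv : v ∈ below b f (f i))
    (hw : w ∈ below b f (f i)) (s t : K) :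
    (s • b i + v) * (t • b i + w) = (s * t) • (b i * b i) + v * w := by
  obtain ⟨-, hv⟩ := H.basis_mul_below hb le_rfl hv
  obtain ⟨hw, -⟩ := H.basis_mul_below hb le_rfl hw
  simp only [add_mul, mul_add, smul_mul_assoc, mul_smul_comm, hv, hw, smul_zero, add_zero,
    zero_add, smul_smul, mul_comm]

theorem pair_mul_pair (h2 : (2 : K) ≠ 0) (hpq : (p, q) ∈ blockPairs (structureMatrix b)) {v w : E}
    (hv : v ∈ below b f (f p)) (hw : w ∈ below b f (f p)) (s t s' t' : K) :
    (s • b p + t • b q + v) * (s' • b p + t' • b q + w) =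
      (s * s') • (b p * b p) + (t * t') • (b q * b q) + v * w := by
  have hne := (entries_of_mem_blockPairs hpq).1
  have hqp := (H.eq_snd h2 hpq).ge
  simp only [add_mul, mul_add, smul_mul_assoc, mul_smul_comm, smul_smul,
    (H.basis_mul_below hb le_rfl hv).2, (H.basis_mul_below hb hqp hv).2,
    (H.basis_mul_below hb le_rfl hw).1, (H.basis_mul_below hb hqp hw).1, hb p q hne,
    hb q p hne.symm, smul_zero, add_zero, zero_add, mul_comm]

/-- The squares of the two vectors of a pair add up to a vector of the lower blocks. -/
theorem pair_sum_mem_below (h2 : (2 : K) ≠ 0) (hpq : (p, q) ∈ blockPairs (structureMatrix b)) :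
    b p * b p + b q * b q ∈ below b f (f p) := by
  obtain ⟨-, ⟨h11, h12⟩, h21, h22⟩ := entries_of_mem_blockPairs hpq
  have hqp := H.eq_snd h2 hpq
  refine mem_below.2 fun j hj => ?_
  rcases hj.eq_or_lt with hj | hj
  · rcases (H.eq_iff h2 hpq j).1 hj.symm with rfl | rfl
    · simp [h11, h21]
    · simp [h12, h22]
  · rw [map_add, Finsupp.add_apply, H.triangular p j hj, H.triangular q j (hqp ▸ hj), add_zero]

theorem pair_fst_sub_mem_below (h2 : (2 : K) ≠ 0)
    (hpq : (p, q) ∈ blockPairs (structureMatrix b)) :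
    b p * b p - (b p + b q) ∈ below b f (f p) := by
  obtain ⟨hne, ⟨h11, h12⟩, -, -⟩ := entries_of_mem_blockPairs hpq
  refine mem_below.2 fun j hj => ?_
  rcases hj.eq_or_lt with hj | hj
  · rcases (H.eq_iff h2 hpq j).1 hj.symm with rfl | rfl
    · simp [h11, hne.symm]
    · simp [h12, hne]
  · have h3 : p ≠ j := by rintro rfl; exact lt_irrefl _ hj
    have h4 : q ≠ j := by
      rintro rfl
      exact hj.ne' (H.eq_snd h2 hpq)
    simp [H.triangular p j hj, h3, h4]

theorem pair_snd_add_mem_below (h2 : (2 : K) ≠ 0)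
    (hpq : (p, q) ∈ blockPairs (structureMatrix b)) :
    b q * b q + (b p + b q) ∈ below b f (f p) := by
  have := sub_mem (H.pair_sum_mem_below hb h2 hpq) (H.pair_fst_sub_mem_below hb h2 hpq)
  rwa [show b p * b p + b q * b q - (b p * b p - (b p + b q)) = b q * b q + (b p + b q) by abel]
    at this

theorem mul_mem_below_of_single {i : Fin n} (hi : IsSingle b f i) {x y : E}
    (hx : x ∈ below b f (f i + 1)) (hy : y ∈ below b f (f i + 1)) :
    x * y ∈ below b f (f i) := by
  obtain ⟨v, hv, hx'⟩ := H.exists_single_add hi hx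
  obtain ⟨w, hw, hy'⟩ := H.exists_single_add hi hy
  rw [hx', hy', H.single_mul_single hb hv hw]
  refine add_mem (Submodule.smul_mem _ _ (mem_below.2 fun j hj => ?_)) (H.mul_mem_below hb w hv)
  rcases hj.eq_or_lt with hj | hj
  · rw [(hi.1 j).1 hj.symm, hi.2]
  · exact H.triangular i j hj

theorem repr_mul_pair (h2 : (2 : K) ≠ 0) (hpq : (p, q) ∈ blockPairs (structureMatrix b)) {x y : E}
    (hx : x ∈ below b f (f p + 1)) (hy : y ∈ below b f (f p + 1)) :
    b.repr (x * y) p = b.repr x p * b.repr y p - b.repr x q * b.repr y q ∧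
      b.repr (x * y) q = b.repr x p * b.repr y p - b.repr x q * b.repr y q := by
  obtain ⟨-, ⟨h11, h12⟩, h21, h22⟩ := entries_of_mem_blockPairs hpq
  obtain ⟨v, hv, hx'⟩ := H.exists_pair_add h2 hpq hx
  obtain ⟨w, hw, hy'⟩ := H.exists_pair_add h2 hpq hy
  have hvw := mem_below.1 (H.mul_mem_below hb w hv)
  have e := H.pair_mul_pair hb h2 hpq hv hw (b.repr x p) (b.repr x q) (b.repr y p) (b.repr y q)
  rw [← hx', ← hy'] at e
  rw [e]
  simp only [map_add, map_smul, Finsupp.add_apply, Finsupp.smul_apply, smul_eq_mul, h11, h12, h21,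
    h22, hvw p le_rfl, hvw q (H.eq_snd h2 hpq).ge]
  constructor <;> ring

end Products

/-! ### The span of the lower blocks and the derived series -/

section Levels

variable (hb : IsNaturalBasis b) (hmax : HasMaxSolvabilityIndex K E) (h2 : (2 : K) ≠ 0)
include hb hmax

theorem below_eq_of_single {k : ℕ} (hk : 1 ≤ k) {i : Fin n} (hi : IsSingle b f i)
    (hV : below b f (f i + 1) = derivedTerm K E k) :
    derivedTerm K E (k + 1) = below b f (f i) := by
  have hkn := le_of_below_eq hmax (Nat.lt_succ_self (f i)) hV
  refine derivedTerm_succ_eq_of_le_of_lt hmax b hk hkn ?_ ?_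
  · rw [derivedTerm_succ_le_iff hk, ← hV]
    exact fun x hx y hy => H.mul_mem_below_of_single hb hi hx hy
  · rw [← hV]
    refine lt_of_le_of_ne (below_mono b f (Nat.le_succ _)) fun h => ?_
    have h1 := basis_mem_below (b := b) (Nat.lt_succ_self (f i))
    rw [← h] at h1
    simpa using mem_below.1 h1 i le_rfl

include h2 in
theorem below_eq_of_pair {k : ℕ} (hk : 1 ≤ k) (hpq : (p, q) ∈ blockPairs (structureMatrix b))
    (hV : below b f (f p + 1) = derivedTerm K E k) :
    (∀ x, x ∈ derivedTerm K E (k + 1) ↔ x ∈ below b f (f p + 1) ∧ b.repr x p = b.repr x q) ∧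
      derivedTerm K E (k + 1 + 1) = below b f (f p) := by
  obtain ⟨hne, -⟩ := entries_of_mem_blockPairs hpq
  have hqp := H.eq_snd h2 hpq
  have hkn := le_of_below_eq hmax (Nat.lt_succ_self (f p)) hV
  have hp : b p ∈ below b f (f p + 1) := basis_mem_below (Nat.lt_succ_self _)
  have hq : b q ∈ below b f (f p + 1) := basis_mem_below (by omega)
  have h1 : derivedTerm K E (k + 1) =
      below b f (f p + 1) ⊓ LinearMap.ker (b.coord p - b.coord q) := by
    refine derivedTerm_succ_eq_of_le_of_lt hmax b hk hkn ?_ ?_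
    · rw [derivedTerm_succ_le_iff hk, ← hV]
      intro x hx y hy
      refine ⟨H.mul_mem_below hb y hx, ?_⟩
      obtain ⟨h3, h4⟩ := H.repr_mul_pair hb h2 hpq hx hy
      simp [h3, h4]
    · rw [← hV]
      refine lt_of_le_of_ne inf_le_left fun h => ?_
      rw [← h] at hp
      have := hp.2
      simp [hne.symm] at this
  have hmem : ∀ x, x ∈ derivedTerm K E (k + 1) ↔
      x ∈ below b f (f p + 1) ∧ b.repr x p = b.repr x q := by
    intro x
    rw [h1]
    simp [sub_eq_zero]
  have hpq1 : b p + b q ∈ derivedTerm K E (k + 1) :=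
    (hmem _).2 ⟨add_mem hp hq, by simp [hne, hne.symm]⟩
  have hcoord : b.repr (b p + b q) p ≠ 0 := by simp [hne.symm]
  have hkn' : k + 1 ≤ n := by
    by_contra hlast
    obtain rfl : k = n := by omega
    rw [derivedTerm_last hmax b, Submodule.mem_bot] at hpq1
    exact hcoord (by simp [hpq1])
  refine ⟨hmem, derivedTerm_succ_eq_of_le_of_lt hmax b (by omega) hkn' ?_ ?_⟩
  · rw [derivedTerm_succ_le_iff (by omega)]
    intro x hx y hy
    obtain ⟨hx, hx'⟩ := (hmem x).1 hx
    obtain ⟨hy, hy'⟩ := (hmem y).1 hy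
    obtain ⟨v, hv, hxv⟩ := H.exists_pair_add h2 hpq hx
    obtain ⟨w, hw, hyw⟩ := H.exists_pair_add h2 hpq hy
    rw [hxv, hyw, H.pair_mul_pair hb h2 hpq hv hw, ← hx', ← hy', ← smul_add]
    exact add_mem (Submodule.smul_mem _ _ (H.pair_sum_mem_below hb h2 hpq))
      (H.mul_mem_below hb w hv)
  · refine lt_of_le_of_ne (fun x hx => (hmem x).2 ⟨below_mono b f (Nat.le_succ _) hx, ?_⟩)
      fun h => ?_
    · rw [mem_below.1 hx p le_rfl, mem_below.1 hx q hqp.ge]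
    · rw [← h] at hpq1
      exact hcoord (mem_below.1 hpq1 p le_rfl)

include h2 in
/-- Each span of lower blocks is a term of the derived series. -/
theorem exists_below_eq_derivedTerm (t : ℕ) : ∃ k, 1 ≤ k ∧ below b f t = derivedTerm K E k := by
  have hN : ∀ i, f i < Finset.univ.sup f + 1 := fun i =>
    Nat.lt_succ_of_le (Finset.le_sup (Finset.mem_univ i))
  generalize Finset.univ.sup f + 1 = N at hN
  have : ∀ s t, N ≤ t + s → ∃ k, 1 ≤ k ∧ below b f t = derivedTerm K E k := by
    intro s
    induction s with
    | zero =>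
      intro t ht
      refine ⟨1, le_rfl, eq_top_iff.2 fun x _ => mem_below.2 fun i hi => ?_⟩
      have := hN i
      omega
    | succ s ih =>
      intro t ht
      obtain ⟨k, hk, hV⟩ := ih (t + 1) (by omega)
      by_cases hex : ∃ i, f i = t
      · obtain ⟨i, rfl⟩ := hex
        rcases H.isSingle_or i with hi | ⟨p, q, hpq, hi⟩
        · exact ⟨k + 1, by omega, (H.below_eq_of_single hb hmax hk hi hV).symm⟩
        · have hip : f i = f p := (H.eq_iff h2 hpq i).2 hi
          rw [hip] at hV ⊢
          exact ⟨k + 1 + 1, by omega, (H.below_eq_of_pair hb hmax h2 hk hpq hV).2.symm⟩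
      · push Not at hex
        exact ⟨k, hk, (below_succ_eq_below hex).symm.trans hV⟩
  exact this N t (by omega)

theorem belowSq_eq {k t : ℕ} (hk : 1 ≤ k) (hV : below b f t = derivedTerm K E k) :
    belowSq b f t = derivedTerm K E (k + 1) := by
  rw [belowSq, hV, derivedTerm_succ hk]

include h2 in
theorem belowSq_single {i : Fin n} (hi : IsSingle b f i) :
    belowSq b f (f i + 1) = below b f (f i) := by
  obtain ⟨k, hk, hV⟩ := H.exists_below_eq_derivedTerm hb hmax h2 (f i + 1)
  rw [H.belowSq_eq hb hmax hk hV, H.below_eq_of_single hb hmax hk hi hV]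

include h2 in
theorem mem_belowSq_pair (hpq : (p, q) ∈ blockPairs (structureMatrix b)) {x : E} :
    x ∈ belowSq b f (f p + 1) ↔ x ∈ below b f (f p + 1) ∧ b.repr x p = b.repr x q := by
  obtain ⟨k, hk, hV⟩ := H.exists_below_eq_derivedTerm hb hmax h2 (f p + 1)
  rw [H.belowSq_eq hb hmax hk hV, (H.below_eq_of_pair hb hmax h2 hk hpq hV).1]

include h2 in
/-- The square of the vector of a `1 × 1` block is not a combination of products of lower vectors:
otherwise the derived series would become stationary there. -/
theorem single_notMem_belowSq {i j : Fin n} (hi : IsSingle b f i) (hj : f j < f i) :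
    b i * b i ∉ belowSq b f (f i) := by
  obtain ⟨k, hk, hV⟩ := H.exists_below_eq_derivedTerm hb hmax h2 (f i + 1)
  have h1 := H.below_eq_of_single hb hmax hk hi hV
  rw [H.belowSq_eq hb hmax (by omega) h1.symm]
  have hkn := le_of_below_eq hmax hj h1.symm
  intro hsq
  refine (derivedTerm_succ_lt hmax b (by omega) hkn).not_ge ?_
  rw [derivedTerm_succ_le_iff hk, ← hV]
  intro x hx y hy
  obtain ⟨v, hv, hx⟩ := H.exists_single_add hi hx
  obtain ⟨w, hw, hy⟩ := H.exists_single_add hi hy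
  rw [hx, hy, H.single_mul_single hb hv hw]
  rw [← h1] at hv hw
  exact add_mem (Submodule.smul_mem _ _ hsq) (mul_mem_derivedTerm_succ (by omega) hv hw)

include h2 in
/-- The common square of `e_p + e_q` and `e_p - e_q` is not a combination of products of lower
vectors: otherwise the derived series would become stationary there. -/
theorem pair_notMem_belowSq {j : Fin n} (hpq : (p, q) ∈ blockPairs (structureMatrix b))
    (hj : f j < f p) : b p * b p + b q * b q ∉ belowSq b f (f p) := by
  obtain ⟨k, hk, hV⟩ := H.exists_below_eq_derivedTerm hb hmax h2 (f p + 1)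
  obtain ⟨h1, h3⟩ := H.below_eq_of_pair hb hmax h2 hk hpq hV
  rw [H.belowSq_eq hb hmax (by omega) h3.symm]
  have hkn := le_of_below_eq hmax hj h3.symm
  intro hsq
  refine (derivedTerm_succ_lt hmax b (by omega) hkn).not_ge ?_
  rw [derivedTerm_succ_le_iff (by omega)]
  intro x hx y hy
  obtain ⟨hx, hx'⟩ := (h1 x).1 hx
  obtain ⟨hy, hy'⟩ := (h1 y).1 hy
  obtain ⟨v, hv, hxv⟩ := H.exists_pair_add h2 hpq hx
  obtain ⟨w, hw, hyw⟩ := H.exists_pair_add h2 hpq hy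
  rw [hxv, hyw, H.pair_mul_pair hb h2 hpq hv hw, ← hx', ← hy', ← smul_add]
  rw [← h3] at hv hw
  exact add_mem (Submodule.smul_mem _ _ hsq) (mul_mem_derivedTerm_succ (by omega) hv hw)

end Levels

end IsBlockNumbering

/-! ### The shape of subalgebras in block form -/

/-- Below level `t` the subalgebra `U` contains every `1 × 1` block, and it contains each pair
`e_p, e_q` or at least `e_p - e_q`, in which case the elements of `U` have no other part there. -/
def IsRegular (b : Basis (Fin n) K E) (f : Fin n → ℕ) (U : NonUnitalSubalgebra K E) (t : ℕ) :
    Prop :=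
  (∀ i, IsSingle b f i → f i < t → b i ∈ U) ∧
    ∀ p q, (p, q) ∈ blockPairs (structureMatrix b) → f p < t →
      (b p ∈ U ∧ b q ∈ U) ∨
        (b p - b q ∈ U ∧ ∀ x ∈ U, x ∈ below b f t → b.repr x p + b.repr x q = 0)

namespace IsRegular

variable {b : Basis (Fin n) K E} {f : Fin n → ℕ} {U : NonUnitalSubalgebra K E} {s t : ℕ}

theorem of_forall_le (h : ∀ i, t ≤ f i) : IsRegular b f U t :=
  ⟨fun i _ hi => absurd (h i) (not_le.2 hi), fun p _ _ hp => absurd (h p) (not_le.2 hp)⟩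

theorem mono (h : IsRegular b f U t) (hst : s ≤ t) : IsRegular b f U s :=
  ⟨fun i hi his => h.1 i hi (his.trans_le hst), fun p q hpq hps =>
    (h.2 p q hpq (hps.trans_le hst)).imp id fun h3 =>
      ⟨h3.1, fun x hx hxs => h3.2 x hx (below_mono b f hst hxs)⟩⟩

theorem sub_mem (h : IsRegular b f U t) {p q : Fin n}
    (hpq : (p, q) ∈ blockPairs (structureMatrix b)) (hp : f p < t) : b p - b q ∈ U :=
  (h.2 p q hpq hp).elim (fun h3 => _root_.sub_mem h3.1 h3.2) fun h3 => h3.1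

end IsRegular

namespace IsBlockNumbering

variable {b : Basis (Fin n) K E} {f : Fin n → ℕ} {p q : Fin n} {U : NonUnitalSubalgebra K E}
  {t : ℕ} (H : IsBlockNumbering b f) (hb : IsNaturalBasis b) (h2 : (2 : K) ≠ 0)
include H hb h2

/-- If `v` multiplies `e_p - e_q ∈ U` into `U`, then its part in an incomplete pair is a
multiple of `e_p - e_q`, as `v (e_p - e_q)` has the part `(v_p + v_q) (e_p + e_q)` there. -/
theorem mem_of_mul_mem (hU : IsRegular b f U t) {v : E} (hv : v ∈ below b f t)
    (hmul : ∀ p q, (p, q) ∈ blockPairs (structureMatrix b) → f p < t → b p - b q ∈ U →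
      v * (b p - b q) ∈ U) : v ∈ U := by
  have hlt : ∀ i, b.repr v i ≠ 0 → f i < t := fun i hi => by
    by_contra h
    exact hi (mem_below.1 hv i (not_lt.1 h))
  refine H.mem_of_blocks h2 (X := U.toSubmodule) (fun i hi h0 => hU.1 i hi (hlt i h0))
    fun p q hpq h0 => ?_
  have hp : f p < t := h0.elim (hlt p) fun h => H.eq_snd h2 hpq ▸ hlt q h
  rcases hU.2 p q hpq hp with ⟨h3, h4⟩ | ⟨h3, h4⟩
  · exact add_mem (SMulMemClass.smul_mem _ h3) (SMulMemClass.smul_mem _ h4)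
  · obtain ⟨-, ⟨h11, h12⟩, h21, h22⟩ := entries_of_mem_blockPairs hpq
    have h5 := h4 _ (hmul p q hpq hp h3) (H.mul_mem_below hb _ hv)
    have h6 : v * (b p - b q) = b.repr v p • (b p * b p) - b.repr v q • (b q * b q) := by
      rw [mul_sub, mul_comm_of_isNaturalBasis hb v (b p), mul_comm_of_isNaturalBasis hb v (b q),
        basis_mul hb v p, basis_mul hb v q]
    rw [h6] at h5
    simp only [map_sub, map_smul, Finsupp.sub_apply, Finsupp.smul_apply, smul_eq_mul, h11, h12,
      h21, h22] at h5
    have h7 : 2 * (b.repr v p + b.repr v q) = 0 := by linear_combination h5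
    have h8 : b.repr v q = -b.repr v p :=
      (neg_eq_of_add_eq_zero_right ((mul_eq_zero.1 h7).resolve_left h2)).symm
    rw [h8, neg_smul, ← sub_eq_add_neg, ← smul_sub]
    exact SMulMemClass.smul_mem _ h3

theorem single_mem {i : Fin n} (hi : IsSingle b f i) (hU : IsRegular b f U (f i)) {x : E}
    (hx : x ∈ U) (hxi : x ∈ below b f (f i + 1)) (h0 : b.repr x i ≠ 0) : b i ∈ U := by
  obtain ⟨v, hv, hxv⟩ := H.exists_single_add hi hxi
  have hvU : v ∈ U := by
    refine H.mem_of_mul_mem hb h2 hU hv fun p q hpq hp hU' => ?_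
    have h3 : x * (b p - b q) ∈ U := mul_mem hx hU'
    have h4 : b p - b q ∈ below b f (f i) :=
      sub_mem (basis_mem_below hp) (basis_mem_below (H.eq_snd h2 hpq ▸ hp))
    rwa [hxv, add_mul, smul_mul_assoc, (H.basis_mul_below hb le_rfl h4).1, smul_zero,
      zero_add] at h3
  have h3 : b.repr x i • b i ∈ U := by
    have := sub_mem hx hvU
    rwa [sub_eq_of_eq_add hxv] at this
  exact (Submodule.smul_mem_iff U.toSubmodule h0).1 h3

theorem pair_part_mem (hpq : (p, q) ∈ blockPairs (structureMatrix b))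
    (hU : IsRegular b f U (f p)) {x : E} (hx : x ∈ U) (hxp : x ∈ below b f (f p + 1)) :
    b.repr x p • b p + b.repr x q • b q ∈ U := by
  obtain ⟨v, hv, hxv⟩ := H.exists_pair_add h2 hpq hxp
  have hvU : v ∈ U := by
    refine H.mem_of_mul_mem hb h2 hU hv fun p' q' hpq' hp hU' => ?_
    have h3 : x * (b p' - b q') ∈ U := mul_mem hx hU'
    have h4 : b p' - b q' ∈ below b f (f p) :=
      sub_mem (basis_mem_below hp) (basis_mem_below (H.eq_snd h2 hpq' ▸ hp))
    have h5 := H.pair_mul_pair hb h2 hpq hv h4 (b.repr x p) (b.repr x q) 0 0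
    rw [← hxv] at h5
    simp only [mul_zero, zero_smul, zero_add] at h5
    rwa [h5] at h3
  have := sub_mem hx hvU
  rwa [sub_eq_of_eq_add hxv] at this

theorem isRegular_succ_of_single {i : Fin n} (hi : IsSingle b f i) (hU : IsRegular b f U (f i))
    (hiU : b i ∈ U) : IsRegular b f U (f i + 1) := by
  refine ⟨fun j hj hjt => ?_, fun p q hpq hp => ?_⟩
  · rcases (Nat.lt_succ_iff.1 hjt).eq_or_lt with h | h
    · rwa [(hi.1 j).1 h]
    · exact hU.1 j hj h
  · have hne := H.ne_of_isSingle h2 hi hpq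
    refine (hU.2 p q hpq (by omega)).imp id fun h3 => ⟨h3.1, fun x hx hxi => ?_⟩
    obtain ⟨v, hv, hxv⟩ := H.exists_single_add hi hxi
    have hvU : v ∈ U := by
      have := sub_mem hx (SMulMemClass.smul_mem (b.repr x i) hiU)
      rwa [sub_eq_of_eq_add' hxv] at this
    have h4 : i ≠ p := by rintro rfl; exact hne rfl
    have h5 : i ≠ q := by
      rintro rfl
      exact hne (H.eq_snd h2 hpq)
    have := h3.2 v hvU hv
    rw [hxv]
    simpa [h4, h5] using this

theorem isRegular_succ_of_pair (hpq : (p, q) ∈ blockPairs (structureMatrix b))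
    (hU : IsRegular b f U (f p)) (hpqU : b p - b q ∈ U) : IsRegular b f U (f p + 1) := by
  refine ⟨fun j hj hjt => ?_, fun p' q' hpq' hp => ?_⟩
  · have hne := H.ne_of_isSingle h2 hj hpq
    exact hU.1 j hj (by omega)
  · rcases (Nat.lt_succ_iff.1 hp).eq_or_lt with h | h
    · obtain ⟨rfl, rfl⟩ := H.eq_and_eq h2 hpq hpq' h
      by_cases hall : ∀ x ∈ U, x ∈ below b f (f p' + 1) → b.repr x p' + b.repr x q' = 0
      · exact Or.inr ⟨hpqU, hall⟩
      · push Not at hall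
        obtain ⟨x, hx, hxp, h0⟩ := hall
        have h3 := add_mem (H.pair_part_mem hb h2 hpq hU hx hxp)
          (SMulMemClass.smul_mem (b.repr x q') hpqU)
        have h4 : (b.repr x p' + b.repr x q') • b p' ∈ U := by
          convert h3 using 1
          module
        have h5 : b p' ∈ U := (Submodule.smul_mem_iff U.toSubmodule h0).1 h4
        exact Or.inl ⟨h5, by simpa using sub_mem h5 hpqU⟩
    · refine (hU.2 p' q' hpq' h).imp id fun h3 => ⟨h3.1, fun x hx hxp => ?_⟩
      obtain ⟨v, hv, hxv⟩ := H.exists_pair_add h2 hpq hxp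
      have hvU : v ∈ U := by
        have := sub_mem hx (H.pair_part_mem hb h2 hpq hU hx hxp)
        rwa [sub_eq_of_eq_add' hxv] at this
      have hqp := H.eq_snd h2 hpq
      have hqp' := H.eq_snd h2 hpq'
      have h4 : ∀ i j, f i = f p → f j = f p' → i ≠ j := by
        rintro i j hi hj rfl
        omega
      have := h3.2 v hvU hv
      rw [hxv]
      simpa [h4 p p' rfl rfl, h4 p q' rfl hqp', h4 q p' hqp rfl, h4 q q' hqp hqp'] using this

variable (hmax : HasMaxSolvabilityIndex K E)
include hmax

/-- A subalgebra that has an element of `below b f t` which is not a combination of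
products of such elements is regular below `t`. By induction, since in the top block it then has an
element whose square has the same property one block lower. -/
theorem isRegular_of_notMem_belowSq {x : E} (hx : x ∈ U) (hxt : x ∈ below b f t)
    (hx' : x ∉ belowSq b f t) : IsRegular b f U t := by
  induction t generalizing x with
  | zero => exact ⟨fun _ _ h => absurd h (Nat.not_lt_zero _),
      fun _ _ _ h => absurd h (Nat.not_lt_zero _)⟩
  | succ t ih =>
    by_cases hex : ∃ i, f i = t
    swap
    · push Not at hex
      have hlt : ∀ i, f i < t + 1 → f i < t := fun i hi => by
        have := hex i
        omega
      have e := below_succ_eq_below (b := b) hex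
      rw [belowSq, e] at hx'
      rw [e] at hxt
      have hU := ih hx hxt hx'
      exact ⟨fun i hi hit => hU.1 i hi (hlt i hit), fun p q hpq hp => by
        rw [e]
        exact hU.2 p q hpq (hlt p hp)⟩
    obtain ⟨i, rfl⟩ := hex
    have hstep : ∀ y ∈ U, ∀ (s : K) (z w : E), s ≠ 0 → w ∈ belowSq b f (f i) →
        z ∈ below b f (f i) → (∀ j, f j < f i → z ∉ belowSq b f (f i)) → y * y = s • z + w →
        IsRegular b f U (f i) := by
      intro y hy s z w hs hw hz hz' hyy
      by_cases hbot : ∃ j, f j < f i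
      · obtain ⟨j, hj⟩ := hbot
        refine ih (x := y * y) (mul_mem hy hy) ?_ ?_
        · rw [hyy]
          refine add_mem (Submodule.smul_mem _ _ hz) ?_
          refine (Submodule.map₂_le.2 fun u hu v _ => ?_ : belowSq b f (f i) ≤ _) hw
          exact H.mul_mem_below hb v hu
        · rw [hyy, Submodule.add_mem_iff_left _ hw, Submodule.smul_mem_iff _ hs]
          exact hz' j hj
      · push Not at hbot
        exact .of_forall_le hbot
    rcases H.isSingle_or i with hi | ⟨p, q, hpq, hi⟩
    · rw [H.belowSq_single hb hmax h2 hi] at hx'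
      obtain ⟨v, hv, hxv⟩ := H.exists_single_add hi hxt
      have h0 : b.repr x i ≠ 0 := by
        intro h0
        rw [h0, zero_smul, zero_add] at hxv
        exact hx' (hxv ▸ hv)
      have hU : IsRegular b f U (f i) := by
        refine hstep x hx _ (b i * b i) (v * v) (mul_ne_zero h0 h0)
          (mul_mem_belowSq hv hv) ?_ (fun j hj => H.single_notMem_belowSq hb hmax h2 hi hj)
          ?_
        · exact H.mul_mem_below_of_single hb hi (basis_mem_below (Nat.lt_succ_self _))
            (basis_mem_below (Nat.lt_succ_self _))
        · conv_lhs => rw [hxv]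
          exact H.single_mul_single hb hv hv _ _
      exact H.isRegular_succ_of_single hb h2 hi hU (H.single_mem hb h2 hi hU hx hxt h0)
    · have hip : f i = f p := (H.eq_iff h2 hpq i).2 hi
      rw [hip] at hxt hx' hstep ⊢
      rw [H.mem_belowSq_pair hb hmax h2 hpq, not_and] at hx'
      have hd := sub_ne_zero.2 (hx' hxt)
      set d := b.repr x p - b.repr x q with hd'
      -- the combination of `x` and `x ^ 2` whose part in the pair is `e_p - e_q`
      set y := (2 / d) • x - (1 / d ^ 2) • (x * x) with hy'
      have hy : y ∈ U := sub_mem (SMulMemClass.smul_mem _ hx)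
        (SMulMemClass.smul_mem _ (mul_mem hx hx))
      have hyt : y ∈ below b f (f p + 1) := sub_mem (Submodule.smul_mem _ _ hxt)
        (Submodule.smul_mem _ _ (H.mul_mem_below hb _ hxt))
      obtain ⟨h3, h4⟩ := H.repr_mul_pair hb h2 hpq hxt hxt
      have hyp : b.repr y p = 1 := by
        rw [hy', map_sub, map_smul, map_smul, Finsupp.sub_apply, Finsupp.smul_apply,
          Finsupp.smul_apply, h3, smul_eq_mul, smul_eq_mul]
        field_simp
        rw [hd']
        ring
      have hyq : b.repr y q = -1 := by
        rw [hy', map_sub, map_smul, map_smul, Finsupp.sub_apply, Finsupp.smul_apply,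
          Finsupp.smul_apply, h4, smul_eq_mul, smul_eq_mul]
        field_simp
        rw [hd']
        ring
      obtain ⟨v, hv, hyv⟩ := H.exists_pair_add h2 hpq hyt
      have hU : IsRegular b f U (f p) := by
        refine hstep y hy 1 (b p * b p + b q * b q) (v * v) one_ne_zero
          (mul_mem_belowSq hv hv) (H.pair_sum_mem_below hb h2 hpq)
          (fun j hj => H.pair_notMem_belowSq hb hmax h2 hpq hj) ?_
        conv_lhs => rw [hyv]
        rw [H.pair_mul_pair hb h2 hpq hv hv, hyp, hyq]
        module
      refine H.isRegular_succ_of_pair hb h2 hpq hU ?_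
      have := H.pair_part_mem hb h2 hpq hU hy hyt
      rwa [hyp, hyq, one_smul, neg_one_smul, ← sub_eq_add_neg] at this

/-- A nonzero subalgebra is regular up to its top block, except that its part in the top block may
be spanned by `e_p + e_q`. -/
theorem isRegular_or (hne : U ≠ ⊥) : ∃ t, U.toSubmodule ≤ below b f (t + 1) ∧
    (IsRegular b f U (t + 1) ∨ IsRegular b f U t ∧
      ∃ p q, (p, q) ∈ blockPairs (structureMatrix b) ∧ f p = t ∧ b p + b q ∈ U ∧
        ∀ x ∈ U, b.repr x p = b.repr x q) := by
  classical
  have hex : ∃ t, U.toSubmodule ≤ below b f t := by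
    refine ⟨Finset.univ.sup f + 1, fun x _ => mem_below.2 fun i hi => ?_⟩
    have := Finset.le_sup (f := f) (Finset.mem_univ i)
    omega
  have hT := Nat.find_spec hex
  have hlow := fun l => Nat.find_min hex (m := l)
  generalize Nat.find hex = T at hT hlow
  obtain ⟨t, rfl⟩ : ∃ t, T = t + 1 := by
    refine Nat.exists_eq_succ_of_ne_zero ?_
    rintro rfl
    refine hne (eq_bot_iff.2 fun x hx => NonUnitalAlgebra.mem_bot.2 ?_)
    refine b.repr.injective (Finsupp.ext fun i => ?_)
    simpa using mem_below.1 (hT hx) i (Nat.zero_le _)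
  refine ⟨t, hT, ?_⟩
  have hUt := hlow t (Nat.lt_succ_self t)
  obtain ⟨x, hx, hxt⟩ := SetLike.not_le_iff_exists.1 hUt
  obtain ⟨i, rfl⟩ : ∃ i, f i = t := by
    by_contra! hi
    exact hxt (below_succ_eq_below (b := b) hi ▸ hT hx)
  rcases H.isSingle_or i with hi | ⟨p, q, hpq, hi⟩
  · refine Or.inl (H.isRegular_of_notMem_belowSq hb h2 hmax hx (hT hx) ?_)
    rwa [H.belowSq_single hb hmax h2 hi]
  have hip : f i = f p := (H.eq_iff h2 hpq i).2 hi
  rw [hip] at hT hxt ⊢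
  by_cases hall : ∀ x ∈ U, b.repr x p = b.repr x q
  swap
  · push Not at hall
    obtain ⟨y, hy, hy'⟩ := hall
    refine Or.inl (H.isRegular_of_notMem_belowSq hb h2 hmax hy (hT hy) ?_)
    rw [H.mem_belowSq_pair hb hmax h2 hpq]
    exact fun h => hy' h.2
  obtain ⟨v, hv, hxv⟩ := H.exists_pair_add h2 hpq (hT hx)
  have h0 : b.repr x p ≠ 0 := by
    intro h0
    rw [← hall x hx, h0, zero_smul, zero_smul, zero_add, zero_add] at hxv
    exact hxt (hxv ▸ hv)
  have hU : IsRegular b f U (f p) := by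
    by_cases hbot : ∃ j, f j < f p
    · obtain ⟨j, hj⟩ := hbot
      have hxx : x * x = (b.repr x p * b.repr x p) • (b p * b p + b q * b q) + v * v := by
        conv_lhs => rw [hxv]
        rw [H.pair_mul_pair hb h2 hpq hv hv, ← hall x hx, smul_add]
      refine H.isRegular_of_notMem_belowSq hb h2 hmax (mul_mem hx hx) ?_ ?_
      · rw [hxx]
        exact add_mem (Submodule.smul_mem _ _ (H.pair_sum_mem_below hb h2 hpq))
          (H.mul_mem_below hb _ hv)
      · rw [hxx, Submodule.add_mem_iff_left _ (mul_mem_belowSq hv hv),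
          Submodule.smul_mem_iff _ (mul_ne_zero h0 h0)]
        exact H.pair_notMem_belowSq hb hmax h2 hpq hj
    · push Not at hbot
      exact .of_forall_le hbot
  refine Or.inr ⟨hU, p, q, hpq, rfl, ?_, hall⟩
  have h3 := H.pair_part_mem hb h2 hpq hU hx (hT hx)
  rw [← hall x hx, ← smul_add] at h3
  exact (Submodule.smul_mem_iff U.toSubmodule h0).1 h3

theorem single_mem_of_mem {i : Fin n} (hi : IsSingle b f i) {x : E} (hx : x ∈ U)
    (h0 : b.repr x i ≠ 0) : b i ∈ U := by
  have hne : U ≠ ⊥ := by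
    rintro rfl
    have hx : x = 0 := NonUnitalAlgebra.mem_bot.1 hx
    exact h0 (by simp [hx])
  obtain ⟨t, hT, h⟩ := H.isRegular_or hb h2 hmax hne
  have hit : f i < t + 1 := by
    by_contra h'
    exact h0 (mem_below.1 (hT hx) i (not_lt.1 h'))
  rcases h with h | ⟨h, p, q, hpq, rfl, -⟩
  · exact h.1 i hi hit
  · have := H.ne_of_isSingle h2 hi hpq
    exact h.1 i hi (by omega)

/-- The three possible parts of a subalgebra in a pair that it involves. -/
theorem pair_of_mem (hpq : (p, q) ∈ blockPairs (structureMatrix b)) {x : E} (hx : x ∈ U)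
    (h0 : b.repr x p ≠ 0 ∨ b.repr x q ≠ 0) : (b p ∈ U ∧ b q ∈ U) ∨
      (b p - b q ∈ U ∧ ∀ y ∈ U, b.repr y p + b.repr y q = 0) ∨
      (b p + b q ∈ U ∧ IsRegular b f U (f p) ∧ ∀ y ∈ U, b.repr y p = b.repr y q) := by
  have hne : U ≠ ⊥ := by
    rintro rfl
    have hx : x = 0 := NonUnitalAlgebra.mem_bot.1 hx
    simp [hx] at h0
  obtain ⟨t, hT, h⟩ := H.isRegular_or hb h2 hmax hne
  have hpt : f p < t + 1 := by
    by_contra h'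
    have hq := H.eq_snd h2 hpq
    have h3 := mem_below.1 (hT hx) p (not_lt.1 h')
    have h4 := mem_below.1 (hT hx) q (by omega)
    exact h0.elim (fun h => h h3) fun h => h h4
  rcases h with h | ⟨h, p', q', hpq', rfl, hU, hall⟩
  · refine (h.2 p q hpq hpt).imp id fun h3 => Or.inl ⟨h3.1, fun y hy => h3.2 y hy (hT hy)⟩
  · rcases (Nat.lt_succ_iff.1 hpt).eq_or_lt with h' | h'
    · obtain ⟨rfl, rfl⟩ := H.eq_and_eq h2 hpq' hpq h'
      exact Or.inr (Or.inr ⟨hU, h, hall⟩)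
    · refine (h.2 p q hpq h').imp id fun h3 => Or.inl ⟨h3.1, fun y hy => ?_⟩
      obtain ⟨v, hv, hyv⟩ := H.exists_pair_add h2 hpq' (hT hy)
      have hvU : v ∈ U := by
        have := sub_mem hy (H.pair_part_mem hb h2 hpq' h hy (hT hy))
        rwa [sub_eq_of_eq_add' hyv] at this
      have hqp := H.eq_snd h2 hpq
      have hqp' := H.eq_snd h2 hpq'
      have h4 : ∀ i j, f i = f p' → f j = f p → i ≠ j := by
        rintro i j hi hj rfl
        omega
      have := h3.2 v hvU hv
      rw [hyv]
      simpa [h4 p' p rfl rfl, h4 p' q rfl hqp, h4 q' p hqp' rfl, h4 q' q hqp' hqp] using this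

end IsBlockNumbering

/-! ### Obstructing subalgebras and modularity -/

namespace IsBlockNumbering

variable {b : Basis (Fin n) K E} {f : Fin n → ℕ} (H : IsBlockNumbering b f)
  (hb : IsNaturalBasis b) (h2 : (2 : K) ≠ 0)

/-- The linear form `x ↦ x_p + x_q`. It vanishes at `x` just if the part of `x` in the pair `p, q`
is a multiple of `e_p - e_q`. -/
def pairSum (b : Basis (Fin n) K E) (p q : Fin n) : E →ₗ[K] K := b.coord p + b.coord q

theorem pairSum_apply (b : Basis (Fin n) K E) (p q : Fin n) (x : E) :
    pairSum b p q x = b.repr x p + b.repr x q := rfl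

theorem pairProj_apply (b : Basis (Fin n) K E) (p q : Fin n) (x : E) :
    pairProj b p q x = b.repr x p • b p + b.repr x q • b q := by
  simp [pairProj]

theorem smul_basis_sub_mem {b : Basis (Fin n) K E} {X : Submodule K E} {p q : Fin n} {x : E}
    (h : pairSum b p q x = 0) (hX : b p - b q ∈ X) :
    b.repr x p • b p + b.repr x q • b q ∈ X := by
  rw [pairSum_apply] at h
  rw [(neg_eq_of_add_eq_zero_right h).symm, neg_smul, ← sub_eq_add_neg, ← smul_sub]
  exact X.smul_mem _ hX

include H in
theorem pairSum_eq_zero {p q : Fin n} (hpq : (p, q) ∈ blockPairs (structureMatrix b))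
    (h2 : (2 : K) ≠ 0) {x : E} (hx : x ∈ below b f (f p)) : pairSum b p q x = 0 := by
  rw [pairSum_apply, mem_below.1 hx p le_rfl, mem_below.1 hx q (H.eq_snd h2 hpq).ge, add_zero]

include H hb h2

/-- Assume that the part of `U` in a pair `i, i'` is `e_i - e_i'`, and its top part is
`e_j + ε e_j'`. If there is no obstructing subalgebra, then the squares of `e_j`, `e_j'` have a
multiple of `e_i - e_i'` as their part in the pair `i, i'`. By induction this holds for each pair
between the two levels in which `U` is incomplete; hence everything below `j` can be added to
`U`, apart from the pair `i, i'`, and the result is a subalgebra as in the definition of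
`HasObstructingSubalgebra`. -/
theorem pairSum_sq_eq_zero (hno : ¬ HasObstructingSubalgebra b) {U : NonUnitalSubalgebra K E}
    {i i' : Fin n} (hi : (i, i') ∈ blockPairs (structureMatrix b)) (N : ℕ) {j j' : Fin n} {ε : K}
    (hN : f j = N) (hj : (j, j') ∈ blockPairs (structureMatrix b)) (hε : ε = 1 ∨ ε = -1)
    (hij : f i < f j) (hU : IsRegular b f U (f j)) (hjU : b j + ε • b j' ∈ U)
    (hiU : ∀ x ∈ U, x ∈ below b f (f j) → pairSum b i i' x = 0) :
    pairSum b i i' (b j * b j) = 0 ∧ pairSum b i i' (b j' * b j') = 0 := by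
  induction N using Nat.strong_induction_on generalizing j j' ε with
  | _ N ih =>
  subst hN
  have hεε : ε * ε = 1 := by rcases hε with rfl | rfl <;> simp
  obtain ⟨hii', -⟩ := entries_of_mem_blockPairs hi
  obtain ⟨hjj', -⟩ := entries_of_mem_blockPairs hj
  have hfi := H.eq_snd h2 hi
  have hfj := H.eq_snd h2 hj
  have hne : ∀ s t, f s = f i → f t = f j → s ≠ t := by
    rintro s t hs ht rfl
    omega
  have n1 := hne i j rfl rfl
  have n2 := hne i j' rfl hfj
  have n3 := hne i' j hfi rfl
  have n4 := hne i' j' hfi hfj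
  -- squares of vectors below the pair `i, i'`, then of vectors between the two levels
  have hlow : ∀ s, f s < f i → pairSum b i i' (b s * b s) = 0 := fun s hs =>
    H.pairSum_eq_zero hi h2 (H.mul_self_mem_below hs)
  have hmem : ∀ s, f s < f j → b s ∈ U → pairSum b i i' (b s * b s) = 0 := fun s hs hsU =>
    hiU _ (mul_mem hsU hsU) (H.mul_self_mem_below hs)
  have hpair : ∀ l l', (l, l') ∈ blockPairs (structureMatrix b) → f i < f l → f l < f j →
      pairSum b i i' (b l * b l) = 0 ∧ pairSum b i i' (b l' * b l') = 0 := by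
    intro l l' hl hil hlj
    rcases hU.2 l l' hl hlj with ⟨h3, h4⟩ | ⟨h3, -⟩
    · exact ⟨hmem l hlj h3, hmem l' (H.eq_snd h2 hl ▸ hlj) h4⟩
    · exact ih (f l) hlj rfl hl (Or.inr rfl) hil (hU.mono hlj.le)
        (by rwa [neg_one_smul, ← sub_eq_add_neg])
        fun x hx hxl => hiU x hx (below_mono b f hlj.le hxl)
  have hw : pairSum b i i' (b j * b j) + pairSum b i i' (b j' * b j') = 0 := by
    rw [← map_add]
    refine hiU _ ?_ (H.pair_sum_mem_below hb h2 hj)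
    have h3 := mul_mem hjU hjU
    have h4 := smul_add_smul_mul_self hb hjj' 1 ε
    rw [one_smul, hεε, one_mul, one_smul, one_smul] at h4
    rwa [h4] at h3
  let U' : NonUnitalSubalgebra K E :=
    { (below b f (f j + 1) ⊓ LinearMap.ker (pairSum b i i') ⊓
        LinearMap.ker (b.coord j' - ε • b.coord j) : Submodule K E) with
      mul_mem' := by
        rintro x y ⟨⟨hx, hxi⟩, hxj⟩ ⟨⟨hy, hyi⟩, hyj⟩
        have hxi : b.repr x i + b.repr x i' = 0 := hxi
        have hyi : b.repr y i + b.repr y i' = 0 := hyi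
        have hxj : b.repr x j' - ε * b.repr x j = 0 := hxj
        have hyj : b.repr y j' - ε * b.repr y j = 0 := hyj
        obtain ⟨h3, h4⟩ := H.repr_mul_pair hb h2 hj hx hy
        have h5 : b.repr x j * b.repr y j = b.repr x j' * b.repr y j' := by
          rw [sub_eq_zero.1 hxj, sub_eq_zero.1 hyj]
          linear_combination (-(b.repr x j * b.repr y j)) * hεε
        rw [← h5, sub_self] at h3 h4
        refine ⟨⟨H.mul_mem_below hb y hx, ?_⟩, ?_⟩
        swap
        · change b.repr (x * y) j' - ε * b.repr (x * y) j = 0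
          rw [h3, h4, mul_zero, sub_zero]
        rw [mul_eq_sum hb]
        refine H.sum_mem h2 (fun s hs => ?_) fun l l' hl => ?_
        · by_cases h0 : b.repr x s = 0
          · simp [h0]
          have hsj : f s < f j + 1 := by
            by_contra h
            exact h0 (mem_below.1 hx s (not_lt.1 h))
          have h6 := H.ne_of_isSingle h2 hs hi
          have h7 := H.ne_of_isSingle h2 hs hj
          exact Submodule.smul_mem _ _ (hmem s (by omega) (hU.1 s hs (by omega)))
        · have hl' := H.eq_snd h2 hl
          change pairSum b i i' _ = 0
          rw [map_add, map_smul, map_smul, smul_eq_mul, smul_eq_mul]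
          rcases lt_trichotomy (f l) (f i) with h6 | h6 | h6
          · rw [hlow l h6, hlow l' (hl' ▸ h6)]
            ring
          · obtain ⟨rfl, rfl⟩ := H.eq_and_eq h2 hi hl h6
            obtain ⟨-, ⟨h11, h12⟩, h21, h22⟩ := entries_of_mem_blockPairs hi
            rw [pairSum_apply, pairSum_apply, h11, h12, h21, h22]
            linear_combination 2 * b.repr y l * hxi - 2 * b.repr x l' * hyi
          · rcases lt_trichotomy (f l) (f j) with h7 | h7 | h7
            · obtain ⟨h8, h9⟩ := hpair l l' hl h6 h7
              rw [h8, h9]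
              ring
            · obtain ⟨rfl, rfl⟩ := H.eq_and_eq h2 hj hl h7
              rw [← h5, ← mul_add, hw, mul_zero]
            · rw [mem_below.1 hx l h7, mem_below.1 hx l' (hl' ▸ h7)]
              ring }
  have hiU' : b i - b i' ∈ U' := by
    refine ⟨⟨sub_mem (basis_mem_below (by omega)) (basis_mem_below (by omega)), ?_⟩, ?_⟩
    · change pairSum b i i' (b i - b i') = 0
      simp [pairSum_apply, hii', hii'.symm]
    · change b.repr (b i - b i') j' - ε * b.repr (b i - b i') j = 0
      simp [n1, n2, n3, n4]
  have hjU' : b j + ε • b j' ∈ U' := by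
    refine ⟨⟨add_mem (basis_mem_below (by omega))
      (Submodule.smul_mem _ _ (basis_mem_below (by omega))), ?_⟩, ?_⟩
    · change pairSum b i i' (b j + ε • b j') = 0
      simp [pairSum_apply, n1.symm, n2.symm, n3.symm, n4.symm]
    · change b.repr (b j + ε • b j') j' - ε * b.repr (b j + ε • b j') j = 0
      simp [hjj', hjj'.symm]
  have key : pairProj b i i' (b j * b j) ∈ NonUnitalAlgebra.adjoin K {b i - b i'} ∧
      pairProj b i i' (b j' * b j') ∈ NonUnitalAlgebra.adjoin K {b i - b i'} := by
    by_contra hcon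
    refine hno ⟨U', i, i', j, j', {s | f s < f j ∧ s ≠ i ∧ s ≠ i'}, ε,
      lt_of_not_ge fun h => hij.not_ge (H.mono h), hi, hj, by simp, by simp, by simp, by simp [hfj],
      hε, le_antisymm (fun x hx => ?_) (sup_le ?_ ?_), by rwa [not_and_or] at hcon⟩
    · obtain ⟨⟨hxj, hxi⟩, hxε⟩ := hx
      have hxi : b.repr x i + b.repr x i' = 0 := hxi
      have hxε : b.repr x j' - ε * b.repr x j = 0 := hxε
      refine Submodule.mem_sup.2 ⟨x - (b.repr x i • (b i - b i') +
        b.repr x j • (b j + ε • b j')), ?_, b.repr x i • (b i - b i') +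
        b.repr x j • (b j + ε • b j'), ?_, by abel⟩
      · rw [mem_span_image_iff]
        intro s hs
        by_cases h3 : s = i
        · subst h3
          simp [hii', n1.symm, n2.symm]
        by_cases h4 : s = i'
        · subst h4
          simp [hii'.symm, n3.symm, n4.symm]
          linear_combination hxi
        by_cases h5 : s = j
        · subst h5
          simp [hjj', n1, n3]
        by_cases h6 : s = j'
        · subst h6
          simp [hjj'.symm, n2, n4]
          linear_combination hxε
        have h7 : f s ≠ f j := fun h => ((H.eq_iff h2 hj s).1 h).elim h5 h6
        have h8 : ¬ f s < f j := fun h => hs ⟨h, h3, h4⟩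
        simp [Ne.symm h3, Ne.symm h4, Ne.symm h5, Ne.symm h6, mem_below.1 hxj s (by omega)]
      · exact add_mem (Submodule.smul_mem _ _ (Submodule.subset_span (by simp)))
          (Submodule.smul_mem _ _ (Submodule.subset_span (by simp)))
    · rw [Submodule.span_le]
      rintro _ ⟨s, ⟨h3, h4, h5⟩, rfl⟩
      have h6 : s ≠ j := by rintro rfl; exact lt_irrefl _ h3
      have h7 : s ≠ j' := by
        rintro rfl
        exact h3.ne hfj
      refine ⟨⟨basis_mem_below (by omega), ?_⟩, ?_⟩
      · change pairSum b i i' (b s) = 0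
        simp [pairSum_apply, h4, h5]
      · change b.repr (b s) j' - ε * b.repr (b s) j = 0
        simp [h6, h7]
    · rw [Submodule.span_le]
      rintro _ (rfl | rfl)
      · exact hiU'
      · exact hjU'
  have hadj : NonUnitalAlgebra.adjoin K {b i - b i'} ≤ U' :=
    NonUnitalAlgebra.adjoin_le (Set.singleton_subset_iff.2 hiU')
  have hproj : ∀ z : E, pairProj b i i' z ∈ U' → pairSum b i i' z = 0 := by
    rintro z ⟨⟨-, h3⟩, -⟩
    have h3 : b.repr (pairProj b i i' z) i + b.repr (pairProj b i i' z) i' = 0 := h3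
    rw [pairProj_apply, (repr_pair hii' _ _).1, (repr_pair hii' _ _).2] at h3
    exact h3
  exact ⟨hproj _ (hadj key.1), hproj _ (hadj key.2)⟩

/-- Without obstructing subalgebra, a subspace that contains `e_p`, `e_q` and a subalgebra with top
part `e_p + e_q` also contains the squares of `e_p` and `e_q`. This is used for the sum of two
subalgebras that have `e_p + e_q` and `e_p - e_q`, respectively. -/
theorem sq_mem_of_isRegular (hno : ¬ HasObstructingSubalgebra b) {U : NonUnitalSubalgebra K E}
    {p q : Fin n} (hpq : (p, q) ∈ blockPairs (structureMatrix b)) (hU : IsRegular b f U (f p))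
    (hpqU : b p + b q ∈ U) {X : Submodule K E} (hUX : U.toSubmodule ≤ X) (hp : b p ∈ X)
    (hq : b q ∈ X) : b p * b p ∈ X ∧ b q * b q ∈ X := by
  have key : ∀ z ∈ below b f (f p + 1), (∀ i i', (i, i') ∈ blockPairs (structureMatrix b) →
      f i < f p → (∀ x ∈ U, x ∈ below b f (f p) → pairSum b i i' x = 0) →
      pairSum b i i' z = 0) → z ∈ X := by
    intro z hz hzi
    have hlt : ∀ i, b.repr z i ≠ 0 → f i < f p + 1 := fun i hi => by
      by_contra h
      exact hi (mem_below.1 hz i (not_lt.1 h))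
    refine H.mem_of_blocks h2 (fun i hi h0 => ?_) fun i i' hi h0 => ?_
    · have := hlt i h0
      have := H.ne_of_isSingle h2 hi hpq
      exact hUX (hU.1 i hi (by omega))
    · have hip : f i < f p + 1 := h0.elim (hlt i) fun h => H.eq_snd h2 hi ▸ hlt i' h
      rcases (Nat.lt_succ_iff.1 hip).eq_or_lt with h | h
      · obtain ⟨rfl, rfl⟩ := H.eq_and_eq h2 hpq hi h
        exact add_mem (X.smul_mem _ hp) (X.smul_mem _ hq)
      · rcases hU.2 i i' hi h with ⟨h3, h4⟩ | ⟨h3, h4⟩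
        · exact add_mem (X.smul_mem _ (hUX h3)) (X.smul_mem _ (hUX h4))
        · exact smul_basis_sub_mem (hzi i i' hi h h4) (hUX h3)
  have hq' := H.eq_snd h2 hpq
  have h3 : ∀ i i', (i, i') ∈ blockPairs (structureMatrix b) → f i < f p →
      (∀ x ∈ U, x ∈ below b f (f p) → pairSum b i i' x = 0) → _ := fun i i' hi hip hiU =>
    H.pairSum_sq_eq_zero hb h2 hno hi (f p) rfl hpq (Or.inl rfl) hip hU
      (by rwa [one_smul]) hiU
  exact ⟨key _ (H.mul_self_mem_below (by omega)) fun i i' hi hip hiU => (h3 i i' hi hip hiU).1,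
    key _ (H.mul_self_mem_below (by omega)) fun i i' hi hip hiU => (h3 i i' hi hip hiU).2⟩

/-- Without obstructing subalgebra the sum of two subalgebras is a subalgebra. -/
theorem mul_mem_sup (hmax : HasMaxSolvabilityIndex K E) (hno : ¬ HasObstructingSubalgebra b)
    {U V : NonUnitalSubalgebra K E} {x y : E} (hx : x ∈ U) (hy : y ∈ V) :
    x * y ∈ U.toSubmodule ⊔ V.toSubmodule := by
  set X := U.toSubmodule ⊔ V.toSubmodule with hX
  have hUX : U.toSubmodule ≤ X := le_sup_left
  have hVX : V.toSubmodule ≤ X := le_sup_right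
  rw [mul_eq_sum hb]
  refine H.sum_mem h2 (fun i hi => ?_) fun p q hpq => ?_
  · by_cases h0 : b.repr x i = 0
    · simp [h0]
    have := H.single_mem_of_mem hb h2 hmax hi hx h0
    exact X.smul_mem _ (hUX (mul_mem this this : _ ∈ U))
  obtain ⟨hne, -⟩ := entries_of_mem_blockPairs hpq
  by_cases hx0 : b.repr x p ≠ 0 ∨ b.repr x q ≠ 0
  swap
  · push Not at hx0
    simp [hx0]
  by_cases hy0 : b.repr y p ≠ 0 ∨ b.repr y q ≠ 0
  swap
  · push Not at hy0
    simp [hy0]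
  have hfull : ∀ W : NonUnitalSubalgebra K E, W.toSubmodule ≤ X → b p ∈ W ∧ b q ∈ W →
      ∀ s t : K, s • (b p * b p) + t • (b q * b q) ∈ X := fun W hW h s t =>
    add_mem (X.smul_mem _ (hW (mul_mem h.1 h.1 : _ ∈ W)))
      (X.smul_mem _ (hW (mul_mem h.2 h.2 : _ ∈ W)))
  have hboth : ∀ s t : K, b p + b q ∈ X → b p - b q ∈ X → (b p ∈ X → b q ∈ X →
      b p * b p ∈ X ∧ b q * b q ∈ X) → s • (b p * b p) + t • (b q * b q) ∈ X := by
    intro s t h3 h4 h5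
    have h6 : b p ∈ X := by
      refine (Submodule.smul_mem_iff X h2).1 ?_
      convert add_mem h3 h4 using 1
      module
    obtain ⟨h7, h8⟩ := h5 h6 (by simpa using sub_mem h6 h4)
    exact add_mem (X.smul_mem _ h7) (X.smul_mem _ h8)
  rcases H.pair_of_mem hb h2 hmax hpq hx hx0 with h | ⟨hUm, hU⟩ | ⟨hUp, hUr, hU⟩
  · exact hfull U hUX h _ _
  · rcases H.pair_of_mem hb h2 hmax hpq hy hy0 with h | ⟨hVm, hV⟩ | ⟨hVp, hVr, hV⟩
    · exact hfull V hVX h _ _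
    · have h3 := smul_add_smul_mul_self hb hne 1 (-1)
      have h4 := mul_mem hUm hUm
      rw [one_smul, neg_one_smul, ← sub_eq_add_neg, neg_mul_neg, one_mul, one_smul, one_smul]
        at h3
      rw [h3] at h4
      rw [(neg_eq_of_add_eq_zero_right (hU x hx)).symm,
        (neg_eq_of_add_eq_zero_right (hV y hy)).symm,
        neg_mul_neg, ← smul_add]
      exact X.smul_mem _ (hUX h4)
    · exact hboth _ _ (hVX hVp) (hUX hUm) fun hp hq =>
        H.sq_mem_of_isRegular hb h2 hno hpq hVr hVp hVX hp hq
  · rcases H.pair_of_mem hb h2 hmax hpq hy hy0 with h | ⟨hVm, hV⟩ | ⟨hVp, hVr, hV⟩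
    · exact hfull V hVX h _ _
    · exact hboth _ _ (hUX hUp) (hVX hVm) fun hp hq =>
        H.sq_mem_of_isRegular hb h2 hno hpq hUr hUp hUX hp hq
    · have h3 := smul_add_smul_mul_self hb hne 1 1
      have h4 := mul_mem hUp hUp
      rw [one_smul, one_smul, one_mul, one_smul, one_smul] at h3
      rw [h3] at h4
      rw [← hU x hx, ← hV y hy, ← smul_add]
      exact X.smul_mem _ (hUX h4)

theorem isModularLattice (hmax : HasMaxSolvabilityIndex K E)
    (hno : ¬ HasObstructingSubalgebra b) : IsModularLattice (NonUnitalSubalgebra K E) := by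
  refine ⟨fun {U} V {W} hUW => ?_⟩
  let S : NonUnitalSubalgebra K E :=
    { U.toSubmodule ⊔ V.toSubmodule with
      mul_mem' := by
        intro x y hx hy
        obtain ⟨u, hu, v, hv, rfl⟩ := Submodule.mem_sup.1 hx
        obtain ⟨u', hu', v', hv', rfl⟩ := Submodule.mem_sup.1 hy
        change (u + v) * (u' + v') ∈ U.toSubmodule ⊔ V.toSubmodule
        rw [add_mul, mul_add, mul_add, mul_comm_of_isNaturalBasis hb v u']
        exact add_mem (add_mem (Submodule.mem_sup_left (mul_mem hu hu' : _ ∈ U))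
          (H.mul_mem_sup hb h2 hmax hno hu hv')) (add_mem (H.mul_mem_sup hb h2 hmax hno hu' hv)
          (Submodule.mem_sup_right (mul_mem hv hv' : _ ∈ V))) }
  rintro x ⟨hx, hxW⟩
  have hS : U ⊔ V ≤ S := sup_le (fun y hy => Submodule.mem_sup_left hy)
    fun y hy => Submodule.mem_sup_right hy
  obtain ⟨u, hu, v, hv, rfl⟩ := Submodule.mem_sup.1 (hS hx)
  have hvW : v ∈ W := by simpa using sub_mem hxW (hUW hu)
  exact add_mem ((le_sup_left : U ≤ U ⊔ V ⊓ W) hu) ((le_sup_right : V ⊓ W ≤ _) ⟨hv, hvW⟩)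

/-- An obstructing subalgebra `U` gives the pentagon of `e_j + ε e_j'` and `e_j - ε e_j'`
over the part of `U` below the pair `j, j'`. -/
theorem not_hasObstructingSubalgebra (hmod : IsModularLattice (NonUnitalSubalgebra K E)) :
    ¬ HasObstructingSubalgebra b := by
  rintro ⟨U, i, i', j, j', S, ε, hij, hi, hj, hiS, hi'S, -, -, hε, hU, hcon⟩
  have hεε : ε * ε = 1 := by rcases hε with rfl | rfl <;> simp
  have hε0 : ε ≠ 0 := by
    rintro rfl
    simp at hεε
  obtain ⟨hii', -⟩ := entries_of_mem_blockPairs hi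
  obtain ⟨hjj', -⟩ := entries_of_mem_blockPairs hj
  have hfi := H.eq_snd h2 hi
  have hfj := H.eq_snd h2 hj
  have hlt : f i < f j := by
    refine lt_of_le_of_ne (H.mono hij.le) fun h => hij.ne ?_
    exact (H.eq_and_eq h2 hi hj h.symm).1.symm
  have hne : ∀ s t, f s = f i → f t = f j → s ≠ t := by
    rintro s t hs ht rfl
    omega
  have n1 := hne i j rfl rfl
  have n2 := hne i j' rfl hfj
  have n3 := hne i' j hfi rfl
  have n4 := hne i' j' hfi hfj
  have hiU : b i - b i' ∈ U := by
    change _ ∈ U.toSubmodule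
    rw [hU]
    exact Submodule.mem_sup_right (Submodule.subset_span (by simp))
  have hjU : b j + ε • b j' ∈ U := by
    change _ ∈ U.toSubmodule
    rw [hU]
    exact Submodule.mem_sup_right (Submodule.subset_span (by simp))
  have hsum : ∀ x ∈ U, pairSum b i i' x = 0 := by
    intro x hx
    have hle : U.toSubmodule ≤ LinearMap.ker (pairSum b i i') := by
      rw [hU, sup_le_iff, Submodule.span_le, Submodule.span_le]
      constructor
      · rintro _ ⟨s, hs, rfl⟩
        have h3 : s ≠ i := by rintro rfl; exact hiS hs
        have h4 : s ≠ i' := by rintro rfl; exact hi'S hs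
        simp [pairSum_apply, h3, h4]
      · rintro _ (rfl | rfl)
        · simp [pairSum_apply, hii', hii'.symm]
        · simp [pairSum_apply, n1.symm, n2.symm, n3.symm, n4.symm]
    exact hle hx
  let V : NonUnitalSubalgebra K E :=
    { below b f (f j) with mul_mem' := fun {_ y} hx _ => H.mul_mem_below hb y hx }
  have hsq : ∀ s : K, s * s = 1 → (b j + s • b j') * (b j + s • b j') =
      b j * b j + b j' * b j' := by
    intro s hs
    have h4 := smul_add_smul_mul_self hb hjj' 1 s
    rwa [one_smul, hs, one_mul, one_smul, one_smul] at h4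
  have hV : b j * b j + b j' * b j' ∈ V := H.pair_sum_mem_below hb h2 hj
  have hzero : ∀ (s : K), ∀ v ∈ V, (b j + s • b j') * v = 0 ∧ v * (b j + s • b j') = 0 := by
    intro s v hv
    have h3 := H.basis_mul_below hb le_rfl (show v ∈ below b f (f j) from hv)
    have h4 := H.basis_mul_below hb hfj.ge (show v ∈ below b f (f j) from hv)
    simp only [add_mul, mul_add, smul_mul_assoc, mul_smul_comm, h3, h4, smul_zero, add_zero,
      and_self]
  have hA : ∀ s : K, ∀ a ∈ U ⊓ V, (b j + s • b j') * a ∈ U ⊓ V ∧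
      a * (b j + s • b j') ∈ U ⊓ V := by
    intro s a ha
    obtain ⟨h3, h4⟩ := hzero s a ha.2
    rw [h3, h4]
    exact ⟨zero_mem _, zero_mem _⟩
  have hUV : b j * b j + b j' * b j' ∈ U ⊓ V := ⟨hsq ε hεε ▸ mul_mem hjU hjU, hV⟩
  have hεε' : -ε * -ε = 1 := by rw [neg_mul_neg, hεε]
  let W := extendBy V (b j + ε • b j') (hsq ε hεε ▸ hV) fun v hv => by
    obtain ⟨h3, h4⟩ := hzero ε v hv
    rw [h3, h4]
    exact ⟨zero_mem _, zero_mem _⟩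
  have hVW : V ≤ W := fun v hv => mem_extendBy.2 ⟨v, hv, 0, by simp⟩
  have key : ∀ z ∈ V, (∀ B : NonUnitalSubalgebra K E, b j ∈ B → b j' ∈ B → z ∈ B) →
      pairSum b i i' z = 0 := by
    intro z hz hzB
    obtain ⟨a, ha, s, rfl⟩ := exists_of_isModularLattice hmod (A := U ⊓ V) (W := W)
      (c := b j + ε • b j') (c' := b j + (-ε) • b j') (inf_le_right.trans hVW)
      (mem_extendBy.2 ⟨0, zero_mem _, 1, by simp⟩)
      (by
        intro h
        obtain ⟨v, hv, s, hs⟩ := mem_extendBy.1 h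
        have hv : v ∈ below b f (f j) := hv
        have h3 := congrArg (fun x => b.repr x j) hs
        have h4 := congrArg (fun x => b.repr x j') hs
        simp [hjj', mem_below.1 hv j le_rfl] at h3
        simp [hjj', mem_below.1 hv j' hfj.ge, ← h3] at h4
        exact mul_ne_zero h2 hε0 (by linear_combination -h4))
      (by rwa [hsq ε hεε]) (hA ε) (by rwa [hsq (-ε) hεε']) (hA (-ε)) (hVW hz)
      (by
        intro B _ h3 h4
        have h5 : b j ∈ B := by
          have e : (2 : K) • b j = b j + ε • b j' + (b j + (-ε) • b j') := by module
          exact (Submodule.smul_mem_iff B.toSubmodule h2).1 (e ▸ add_mem h3 h4)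
        have h6 : ε • b j' ∈ B := by simpa using sub_mem h3 h5
        exact hzB B h5 ((Submodule.smul_mem_iff B.toSubmodule hε0).1 h6))
    exact hsum _ (add_mem ha.1 (SMulMemClass.smul_mem _ hjU))
  have hsumj : pairSum b i i' (b j + b j') = 0 := by
    simp [pairSum_apply, n1.symm, n2.symm, n3.symm, n4.symm]
  have h3 : pairSum b i i' (b j * b j) = 0 := by
    have := key _ (H.pair_fst_sub_mem_below hb h2 hj) fun B h3 h4 =>
      sub_mem (mul_mem h3 h3) (add_mem h3 h4)
    rwa [map_sub, hsumj, sub_zero] at this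
  have h4 : pairSum b i i' (b j' * b j') = 0 := by
    have := key _ (H.pair_snd_add_mem_below hb h2 hj) fun B h3 h4 =>
      add_mem (mul_mem h4 h4) (add_mem h3 h4)
    rwa [map_add, hsumj, add_zero] at this
  have hproj : ∀ z, pairSum b i i' z = 0 →
      pairProj b i i' z ∈ NonUnitalAlgebra.adjoin K {b i - b i'} := by
    intro z hz
    rw [pairProj_apply]
    exact smul_basis_sub_mem
      (X := (NonUnitalAlgebra.adjoin K {b i - b i'}).toSubmodule) hz
      (NonUnitalAlgebra.self_mem_adjoin_singleton K _)
  exact hcon.elim (fun h => h (hproj _ h3)) fun h => h (hproj _ h4)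

end IsBlockNumbering

end EvolutionAlgebra

end

/-- Modularity of an evolution algebra with maximum index of solvability. The algebra is modular
when its lattice of subalgebras is modular. The criterion is stated both with an arbitrary
and with a suitable natural basis in block form. -/
theorem mainTheorem4 {K E : Type*} [Field K] [NonUnitalNonAssocRing E] [Module K E]
    [IsScalarTower K E E] [SMulCommClass K E E] {n : ℕ} (h2 : ringChar K ≠ 2)
    (b₀ : Module.Basis (Fin n) K E) (hb₀ : EvolutionAlgebra.IsNaturalBasis b₀)
    (hmax : EvolutionAlgebra.HasMaxSolvabilityIndex K E) :
    (IsModularLattice (NonUnitalSubalgebra K E) ↔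
      EvolutionAlgebra.NoTwoConsecutiveNonBasic b₀ ∧
      ∀ b : Module.Basis (Fin n) K E, EvolutionAlgebra.IsNaturalBasis b →
        EvolutionAlgebra.HasBlockForm (EvolutionAlgebra.structureMatrix b) →
        ¬ EvolutionAlgebra.HasObstructingSubalgebra b) ∧
    (IsModularLattice (NonUnitalSubalgebra K E) ↔
      EvolutionAlgebra.NoTwoConsecutiveNonBasic b₀ ∧
      ∃ b : Module.Basis (Fin n) K E, EvolutionAlgebra.IsNaturalBasis b ∧
        EvolutionAlgebra.HasBlockForm (EvolutionAlgebra.structureMatrix b) ∧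
        ¬ EvolutionAlgebra.HasObstructingSubalgebra b) := by
  have h2' : (2 : K) ≠ 0 := Ring.two_ne_zero h2
  have hno : IsModularLattice (NonUnitalSubalgebra K E) →
      ∀ b : Module.Basis (Fin n) K E, EvolutionAlgebra.IsNaturalBasis b →
        EvolutionAlgebra.HasBlockForm (EvolutionAlgebra.structureMatrix b) →
        ¬ EvolutionAlgebra.HasObstructingSubalgebra b := by
    intro hmod b hb hblock
    obtain ⟨f, H⟩ := EvolutionAlgebra.IsBlockNumbering.of_hasBlockForm hblock
    exact H.not_hasObstructingSubalgebra hb h2' hmod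
  have hmod : ∀ b : Module.Basis (Fin n) K E, EvolutionAlgebra.IsNaturalBasis b →
      EvolutionAlgebra.HasBlockForm (EvolutionAlgebra.structureMatrix b) →
      ¬ EvolutionAlgebra.HasObstructingSubalgebra b →
      IsModularLattice (NonUnitalSubalgebra K E) := by
    intro b hb hblock hobs
    obtain ⟨f, H⟩ := EvolutionAlgebra.IsBlockNumbering.of_hasBlockForm hblock
    exact H.isModularLattice hb h2' hmax hobs
  have htwo := EvolutionAlgebra.noTwoConsecutiveNonBasic_of_isModularLattice h2' hb₀ hmax
  have hex := EvolutionAlgebra.exists_hasBlockForm hb₀ hmax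
  refine ⟨⟨fun h => ⟨htwo h, hno h⟩, ?_⟩, fun h => ⟨htwo h, ?_⟩, ?_⟩
  · rintro ⟨h1, h3⟩
    obtain ⟨b, hb, hblock⟩ := hex h1
    exact hmod b hb hblock (h3 b hb hblock)
  · obtain ⟨b, hb, hblock⟩ := hex (htwo h)
    exact ⟨b, hb, hblock, hno h b hb hblock⟩
  · rintro ⟨-, b, hb, hblock, h3⟩
    exact hmod b hb hblock h3
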